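/- Let $\Bbbk=\mathbb{R}$ or $\mathbb{C}$; all schemes are over $\Bbbk$, $\Bbbk[Z]$ denotes the algebra of global functions of $Z$, and varieties are reduced schemes of finite type, not necessarily irreducible. An affine algebraic Lie groupoid $\mathcal{G}\rightrightarrows X$ is a groupoid object in affine varieties with $\mathcal{G}$ and $X$ smooth and with smooth source and target $\mathsf{s},\mathsf{t}:\mathcal{G}\to X$; write $\mathsf{m}:\mathcal{G}\,{}_{\mathsf{s}}\!\times_{\mathsf{t}}\mathcal{G}\to\mathcal{G}$ for its multiplication and $\mathsf{1}:X\to\mathcal{G}$ for its units. A closed subscheme $\operatorname{Spec}(R/I)$ of an affine scheme $\operatorname{Spec}R$ with a Poisson bracket on $R$ is coisotropic if $\{I,I\}\subseteq I$, and isotropic (when $\operatorname{Spec} R$ and $\operatorname{Spec}(R/I)$ are smooth and the bracket comes from a symplectic form) if the symplectic form pulls back to zero on it. Let $\mathcal{G}\rightrightarrows X$ be an affine symplectic groupoid over $\Bbbk$, i.e. an affine algebraic Lie groupoid with a symplectic form $\omega$ on $\mathcal{G}$ for which the graph of $\mathsf{m}$ is coisotropic in $\mathcal{G}\times\mathcal{G}\times\mathcal{G}^-$,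 where $-$ denotes negation of the symplectic or Poisson structure. Equip $X$ with the Poisson structure for which $\mathsf{s}$ is anti-Poisson and $\mathsf{t}$ is Poisson, let $\sigma:T^*X\to TX$ be contraction with its bivector field, and identify $T^*X$ with the Lie algebroid of $\mathcal{G}$ by sending $df$ to the restriction to the units of the Hamiltonian vector field of $\mathsf{t}^*f$. Let $S\subseteq X$ be a smooth closed coisotropic subvariety with conormal bundle $N^*_SX$, and let $\mathcal{H}\rightrightarrows S$ be a stabilizer subgroupoid, i.e. a closed subgroupoid of $\mathcal{G}$ over $S$ that is itself an affine algebraic Lie groupoid, is isotropic in $\mathcal{G}$, and has $N^*_SX\cap\sigma^{-1}(TS)$ as its Lie algebroid. Let $(M,\mu,\mathcal{A})$ be an affine Hamiltonian $\mathcal{G}$-scheme: $M$ is an affine scheme with a Poisson bracket on $\Bbbk[M]$, $\mu:M\to X$ is a morphism, and $\mathcal{A}:\mathcal{G}\,{}_{\mathsf{s}}\!\times_{\mu}M\to M$ is an action of $\mathcal{G}$ with moment map $\mu$ whose graph is coisotropic in $\mathcal{G}\times M\times M^-$. Write $j:\mu^{-1}(S)\to M$ for the inclusion of the scheme-theoretic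 preimage, let $\overline{\mathsf{s}}:\mathcal{H}\to S$ and $\overline{\mu}:\mu^{-1}(S)\to S$ be the restrictions of $\mathsf{s}$ and $\mu$, let $\mathcal{B}:\mathcal{H}\,{}_{\overline{\mathsf{s}}}\!\times_{\overline{\mu}}\mu^{-1}(S)\to\mu^{-1}(S)$ be the action of $\mathcal{H}$ obtained by restricting $\mathcal{A}$, and set $$\Bbbk[\mu^{-1}(S)]^{\mathcal{H}}=\{f\in\Bbbk[\mu^{-1}(S)] : \mathcal{B}^*f=1\otimes f\}.$$ Then there is a unique Poisson bracket on $\Bbbk[\mu^{-1}(S)]^{\mathcal{H}}$ satisfying $\{j^*f_1,j^*f_2\}=j^*\{f_1,f_2\}$ for all $f_1,f_2\in\Bbbk[M]$ with $j^*f_1,j^*f_2\in\Bbbk[\mu^{-1}(S)]^{\mathcal{H}}$. (The affine Poisson scheme $\operatorname{Spec}\Bbbk[\mu^{-1}(S)]^{\mathcal{H}}$ is called the Hamiltonian reduction of $M$ by $\mathcal{G}$ along $S$ with respect to $\mathcal{H}$.) -/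

import Mathlib

open scoped TensorProduct

noncomputable section

namespace CoisotropicReduction

universe u₁ u₂ u₃ u₄ u₅

/-! ## Fibre products of affine schemes -/

section FibreProducts

variable {𝕜 : Type u₁} [Field 𝕜]
  {A : Type u₂} [CommRing A] [Algebra 𝕜 A]
  {B : Type u₃} [CommRing B] [Algebra 𝕜 B]
  {C : Type u₄} [CommRing C] [Algebra 𝕜 C]

/-- The ideal of `Spec B ×_{Spec A} Spec C` in `Spec B × Spec C`. -/
def fibIdeal (f : A →ₐ[𝕜] B) (g : A →ₐ[𝕜] C) : Ideal (B ⊗[𝕜] C) :=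
  Ideal.span (Set.range fun a : A => f a ⊗ₜ[𝕜] (1 : C) - (1 : B) ⊗ₜ[𝕜] g a)

/-- The coordinate ring `B ⊗_A C` of the fibre product `Spec B ×_{Spec A} Spec C` along the
morphisms with comorphisms `f : A → B` and `g : A → C`, presented as a quotient of `B ⊗ C` over
the ground field (so that no instance-based `A`-algebra structure on `B` or `C` has to be chosen:
a groupoid has two of them). -/
abbrev Fib (f : A →ₐ[𝕜] B) (g : A →ₐ[𝕜] C) : Type (max u₃ u₄) := (B ⊗[𝕜] C) ⧸ fibIdeal f g

/-- The restriction `B ⊗ C → B ⊗_A C`; an element of `B ⊗ C` is a lift of its image. -/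
def Fib.proj (f : A →ₐ[𝕜] B) (g : A →ₐ[𝕜] C) : B ⊗[𝕜] C →ₐ[𝕜] Fib f g :=
  Ideal.Quotient.mkₐ 𝕜 (fibIdeal f g)

/-- `b ↦ b ⊗ 1`, the comorphism of the first projection. -/
def Fib.inl (f : A →ₐ[𝕜] B) (g : A →ₐ[𝕜] C) : B →ₐ[𝕜] Fib f g :=
  (Fib.proj f g).comp Algebra.TensorProduct.includeLeft

/-- `c ↦ 1 ⊗ c`, the comorphism of the second projection. -/
def Fib.inr (f : A →ₐ[𝕜] B) (g : A →ₐ[𝕜] C) : C →ₐ[𝕜] Fib f g :=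
  (Fib.proj f g).comp Algebra.TensorProduct.includeRight

theorem Fib.condition (f : A →ₐ[𝕜] B) (g : A →ₐ[𝕜] C) :
    (Fib.inl f g).comp f = (Fib.inr f g).comp g := by
  ext a
  exact Ideal.Quotient.eq.mpr (Ideal.subset_span ⟨a, rfl⟩)

variable {D : Type u₅} [CommRing D] [Algebra 𝕜 D]

/-- The comorphism `b ⊗ c ↦ u b * v c` of the morphism to the fibre product with components `u`
and `v`. -/
def Fib.lift (f : A →ₐ[𝕜] B) (g : A →ₐ[𝕜] C) (u : B →ₐ[𝕜] D) (v : C →ₐ[𝕜] D)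
    (h : u.comp f = v.comp g) : Fib f g →ₐ[𝕜] D :=
  Ideal.Quotient.liftₐ (fibIdeal f g) (Algebra.TensorProduct.productMap u v) (by
    intro x hx
    have hle : fibIdeal f g ≤ RingHom.ker (Algebra.TensorProduct.productMap u v) := by
      refine Ideal.span_le.mpr ?_
      rintro _ ⟨a, rfl⟩
      have ha := DFunLike.congr_fun h a
      simp only [AlgHom.comp_apply] at ha
      simp [RingHom.mem_ker, ha]
    exact hle hx)

theorem Fib.lift_comp_inl (f : A →ₐ[𝕜] B) (g : A →ₐ[𝕜] C) (u : B →ₐ[𝕜] D) (v : C →ₐ[𝕜] D)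
    (h : u.comp f = v.comp g) : (Fib.lift f g u v h).comp (Fib.inl f g) = u := by
  ext b
  change Algebra.TensorProduct.productMap u v (b ⊗ₜ 1) = u b
  simp

theorem Fib.lift_comp_inr (f : A →ₐ[𝕜] B) (g : A →ₐ[𝕜] C) (u : B →ₐ[𝕜] D) (v : C →ₐ[𝕜] D)
    (h : u.comp f = v.comp g) : (Fib.lift f g u v h).comp (Fib.inr f g) = v := by
  ext c
  change Algebra.TensorProduct.productMap u v (1 ⊗ₜ c) = v c
  simp

/-- The ideal in `(B ⊗ C) ⊗ D` of the graph `{(b, c, a(b, c))}` of a morphism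
`Spec B ×_{Spec A} Spec C → Spec D` with comorphism `a`, as a closed subscheme of
`Spec B × Spec C × Spec D`. -/
def graphIdeal (f : A →ₐ[𝕜] B) (g : A →ₐ[𝕜] C) (a : D →ₐ[𝕜] Fib f g) :
    Ideal ((B ⊗[𝕜] C) ⊗[𝕜] D) :=
  RingHom.ker (Algebra.TensorProduct.productMap (Fib.proj f g) a)

/-! For source and target `s, t : A → B` and a "moment map" `ν : A → C`, the two morphisms
`G ×_X G ×_X M → G ×_X M` given by `(g, h, x) ↦ (gh, x)` and `(g, h, x) ↦ (g, hx)`. -/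

/-- `m* ⊗ id`. -/
def mulTensorId (s t : A →ₐ[𝕜] B) (m : B →ₐ[𝕜] Fib s t)
    (hm : m.comp s = (Fib.inr s t).comp s) (ν : A →ₐ[𝕜] C) :
    Fib s ν →ₐ[𝕜] Fib s ((Fib.inl s ν).comp t) :=
  Fib.lift s ν
    ((Fib.lift s t (Fib.inl s ((Fib.inl s ν).comp t))
      ((Fib.inr s ((Fib.inl s ν).comp t)).comp (Fib.inl s ν))
      (by rw [AlgHom.comp_assoc]; exact Fib.condition _ _)).comp m)
    ((Fib.inr s ((Fib.inl s ν).comp t)).comp (Fib.inr s ν))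
    (by
      rw [AlgHom.comp_assoc, hm, ← AlgHom.comp_assoc, Fib.lift_comp_inr, AlgHom.comp_assoc,
        Fib.condition, AlgHom.comp_assoc])

/-- `id ⊗ a*`. -/
def idTensorAct (s t : A →ₐ[𝕜] B) (ν : A →ₐ[𝕜] C) (a : C →ₐ[𝕜] Fib s ν)
    (ha : a.comp ν = (Fib.inl s ν).comp t) :
    Fib s ν →ₐ[𝕜] Fib s ((Fib.inl s ν).comp t) :=
  Fib.lift s ν (Fib.inl s ((Fib.inl s ν).comp t)) ((Fib.inr s ((Fib.inl s ν).comp t)).comp a)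
    (by rw [AlgHom.comp_assoc, ha]; exact Fib.condition _ _)

end FibreProducts

/-! ## Affine algebraic Lie groupoids and their actions -/

section Groupoids

variable (𝕜 : Type u₁) [Field 𝕜]
  (A : Type u₂) [CommRing A] [Algebra 𝕜 A]
  (B : Type u₃) [CommRing B] [Algebra 𝕜 B]

/-- A groupoid object `G ⇉ X` in affine schemes over `𝕜`, with `X = Spec A` and `G = Spec B`, in
terms of comorphisms. The multiplication is defined on `G ×_{s,t} G`, i.e. on pairs `(g, h)` with
`s(g) = t(h)`. -/
structure AffineGroupoid where
  src : A →ₐ[𝕜] B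
  tgt : A →ₐ[𝕜] B
  unit : B →ₐ[𝕜] A
  inv : B →ₐ[𝕜] B
  mul : B →ₐ[𝕜] Fib src tgt
  unit_src : unit.comp src = AlgHom.id 𝕜 A
  unit_tgt : unit.comp tgt = AlgHom.id 𝕜 A
  inv_src : inv.comp src = tgt
  inv_tgt : inv.comp tgt = src
  /-- `s(gh) = s(h)` -/
  mul_src : mul.comp src = (Fib.inr src tgt).comp src
  /-- `t(gh) = t(g)` -/
  mul_tgt : mul.comp tgt = (Fib.inl src tgt).comp tgt
  /-- `(gh)k = g(hk)` -/
  mul_assoc : (mulTensorId src tgt mul mul_src tgt).comp mul =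
    (idTensorAct src tgt tgt mul mul_tgt).comp mul
  /-- `1_{t(g)} g = g` -/
  one_mul : (Fib.lift src tgt (tgt.comp unit) (AlgHom.id 𝕜 B)
    (by rw [AlgHom.comp_assoc, unit_src, AlgHom.comp_id, AlgHom.id_comp])).comp mul =
      AlgHom.id 𝕜 B
  /-- `g 1_{s(g)} = g` -/
  mul_one : (Fib.lift src tgt (AlgHom.id 𝕜 B) (src.comp unit)
    (by rw [AlgHom.comp_assoc, unit_tgt, AlgHom.comp_id, AlgHom.id_comp])).comp mul =
      AlgHom.id 𝕜 B
  /-- `g g⁻¹ = 1_{t(g)}` -/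
  mul_inv : (Fib.lift src tgt (AlgHom.id 𝕜 B) inv
    (by rw [inv_tgt, AlgHom.id_comp])).comp mul = tgt.comp unit
  /-- `g⁻¹ g = 1_{s(g)}` -/
  inv_mul : (Fib.lift src tgt inv (AlgHom.id 𝕜 B)
    (by rw [inv_src, AlgHom.id_comp])).comp mul = src.comp unit

variable {𝕜 A B}

/-- `G ⇉ X` is an affine algebraic Lie groupoid: `X` and `G` are smooth varieties, and source and
target are smooth morphisms. -/
structure AffineGroupoid.IsLie (G : AffineGroupoid 𝕜 A B) : Prop where
  smooth_base : Algebra.Smooth 𝕜 A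
  smooth_arrows : Algebra.Smooth 𝕜 B
  smooth_src : G.src.toRingHom.Smooth
  smooth_tgt : G.tgt.toRingHom.Smooth

/-- An affine `G`-scheme `(M, μ, 𝒜)` with `M = Spec C`, in terms of comorphisms. The action is
defined on `G ×_{s,μ} M`. -/
structure GScheme (G : AffineGroupoid 𝕜 A B) (C : Type u₄) [CommRing C] [Algebra 𝕜 C] where
  moment : A →ₐ[𝕜] C
  act : C →ₐ[𝕜] Fib G.src moment
  /-- `μ(g x) = t(g)` -/
  act_moment : act.comp moment = (Fib.inl G.src moment).comp G.tgt
  /-- `1_{μ(x)} x = x` -/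
  act_one : (Fib.lift G.src moment (moment.comp G.unit) (AlgHom.id 𝕜 C)
    (by rw [AlgHom.comp_assoc, G.unit_src, AlgHom.comp_id, AlgHom.id_comp])).comp act =
      AlgHom.id 𝕜 C
  /-- `(gh) x = g (h x)` -/
  act_mul : (mulTensorId G.src G.tgt G.mul G.mul_src moment).comp act =
    (idTensorAct G.src G.tgt moment act act_moment).comp act

/-- A closed subgroupoid `H ⇉ S` of `G ⇉ X`, where `S ⊆ X` and `H ⊆ G` are the closed subschemes
with ideals `I` and `J`: a groupoid structure on `H ⇉ S` for which the inclusions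
`S → X` and `H → G` form a morphism of groupoids. -/
structure ClosedSubgroupoid (G : AffineGroupoid 𝕜 A B) (I : Ideal A) (J : Ideal B) extends
    AffineGroupoid 𝕜 (A ⧸ I) (B ⧸ J) where
  incl_src : (Ideal.Quotient.mkₐ 𝕜 J).comp G.src = src.comp (Ideal.Quotient.mkₐ 𝕜 I)
  incl_tgt : (Ideal.Quotient.mkₐ 𝕜 J).comp G.tgt = tgt.comp (Ideal.Quotient.mkₐ 𝕜 I)
  incl_unit : (Ideal.Quotient.mkₐ 𝕜 I).comp G.unit = unit.comp (Ideal.Quotient.mkₐ 𝕜 J)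
  incl_mul : (Fib.lift G.src G.tgt
      ((Fib.inl src tgt).comp (Ideal.Quotient.mkₐ 𝕜 J))
      ((Fib.inr src tgt).comp (Ideal.Quotient.mkₐ 𝕜 J))
      (by rw [AlgHom.comp_assoc, incl_src, ← AlgHom.comp_assoc, Fib.condition, AlgHom.comp_assoc,
        ← incl_tgt, AlgHom.comp_assoc])).comp G.mul =
    mul.comp (Ideal.Quotient.mkₐ 𝕜 J)

variable {G : AffineGroupoid 𝕜 A B} {C : Type u₄} [CommRing C] [Algebra 𝕜 C]

/-- The coordinate ring `𝕜[μ⁻¹(S)]` of the scheme-theoretic preimage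
`μ⁻¹(S) = S ×_X M`, where `S` has ideal `I`. -/
abbrev GScheme.Preimage (M : GScheme G C) (I : Ideal A) : Type (max u₂ u₄) :=
  Fib (Ideal.Quotient.mkₐ 𝕜 I) M.moment

/-- The comorphism `j* : 𝕜[M] → 𝕜[μ⁻¹(S)]` of the inclusion `j : μ⁻¹(S) → M`. -/
def GScheme.restrict (M : GScheme G C) (I : Ideal A) : C →ₐ[𝕜] M.Preimage I :=
  Fib.inr (Ideal.Quotient.mkₐ 𝕜 I) M.moment

/-- The comorphism of the restricted moment map `μ⁻¹(S) → S`. -/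
def GScheme.preimageMoment (M : GScheme G C) (I : Ideal A) : A ⧸ I →ₐ[𝕜] M.Preimage I :=
  Fib.inl (Ideal.Quotient.mkₐ 𝕜 I) M.moment

variable {I : Ideal A} {J : Ideal B}

/-- `k* ⊗ j* : 𝕜[G] ⊗_{𝕜[X]} 𝕜[M] → 𝕜[H] ⊗_{𝕜[S]} 𝕜[μ⁻¹(S)]`. -/
def GScheme.restrictTensor (M : GScheme G C) (H : ClosedSubgroupoid G I J) :
    Fib G.src M.moment →ₐ[𝕜] Fib H.src (M.preimageMoment I) :=
  Fib.lift G.src M.moment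
    ((Fib.inl H.src (M.preimageMoment I)).comp (Ideal.Quotient.mkₐ 𝕜 J))
    ((Fib.inr H.src (M.preimageMoment I)).comp (M.restrict I))
    (by
      rw [AlgHom.comp_assoc, H.incl_src, ← AlgHom.comp_assoc, Fib.condition, AlgHom.comp_assoc,
        AlgHom.comp_assoc]
      congr 1
      exact Fib.condition _ _)

/-- The comorphism `𝕜[μ⁻¹(S)] → 𝕜[H] ⊗_{𝕜[S]} 𝕜[μ⁻¹(S)]` of the action of `H` on `μ⁻¹(S)`
obtained by restricting the action of `G` on `M`. It is determined by
`j* f ↦ (k* ⊗ j*)(𝒜* f)` for `f` in `𝕜[M]`. -/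
def GScheme.restrictAct (M : GScheme G C) (H : ClosedSubgroupoid G I J) :
    M.Preimage I →ₐ[𝕜] Fib H.src (M.preimageMoment I) :=
  Fib.lift (Ideal.Quotient.mkₐ 𝕜 I) M.moment
    ((Fib.inl H.src (M.preimageMoment I)).comp H.tgt)
    ((M.restrictTensor H).comp M.act)
    (by
      rw [AlgHom.comp_assoc, AlgHom.comp_assoc, M.act_moment, ← H.incl_tgt,
        ← AlgHom.comp_assoc (M.restrictTensor H), GScheme.restrictTensor, Fib.lift_comp_inl,
        AlgHom.comp_assoc])

/-- The algebra of invariants `𝕜[μ⁻¹(S)]^H = {f : ℬ* f = 1 ⊗ f}`. -/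
def GScheme.invariants (M : GScheme G C) (H : ClosedSubgroupoid G I J) :
    Subalgebra 𝕜 (M.Preimage I) :=
  AlgHom.equalizer (M.restrictAct H) (Fib.inr H.src (M.preimageMoment I))

end Groupoids

/-! ## Poisson brackets and symplectic forms -/

section Poisson

variable (𝕜 : Type u₁) [Field 𝕜]

/-- A Poisson bracket on a commutative `𝕜`-algebra. -/
structure PoissonBracket (R : Type u₂) [CommRing R] [Algebra 𝕜 R] where
  bracket : R →ₗ[𝕜] R →ₗ[𝕜] R
  bracket_self : ∀ a, bracket a a = 0
  leibniz : ∀ a b c, bracket a (b * c) = bracket a b * c + b * bracket a c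
  jacobi : ∀ a b c,
    bracket a (bracket b c) + bracket b (bracket c a) + bracket c (bracket a b) = 0

variable {𝕜}
  {R : Type u₂} [CommRing R] [Algebra 𝕜 R]
  {R' : Type u₃} [CommRing R'] [Algebra 𝕜 R']

/-- The product bracket on `R ⊗ R'`, i.e. the bilinear map with
`{a ⊗ b, a' ⊗ b'} = {a, a'} ⊗ b b' + a a' ⊗ {b, b'}`. -/
def prodBracket (P : R →ₗ[𝕜] R →ₗ[𝕜] R) (Q : R' →ₗ[𝕜] R' →ₗ[𝕜] R') :
    R ⊗[𝕜] R' →ₗ[𝕜] R ⊗[𝕜] R' →ₗ[𝕜] R ⊗[𝕜] R' :=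
  TensorProduct.map₂ P (LinearMap.mul 𝕜 R') + TensorProduct.map₂ (LinearMap.mul 𝕜 R) Q

/-- The closed subscheme with ideal `I` is coisotropic: `I` is closed under the bracket. -/
def IsCoisotropic (P : R →ₗ[𝕜] R →ₗ[𝕜] R) (I : Ideal R) : Prop :=
  ∀ a ∈ I, ∀ b ∈ I, P a b ∈ I

variable (𝕜 R) in
/-- A symplectic form on the smooth affine variety `Spec R`: a closed, non-degenerate 2-form. As
`Spec R` is smooth, its module of differentials is finitely generated projective, and 2-forms are
the same as alternating bilinear forms on vector fields, i.e. on derivations of `R`. -/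
structure SymplecticForm where
  form : Derivation 𝕜 R R →ₗ[R] Derivation 𝕜 R R →ₗ[R] R
  alternating : ∀ V, form V V = 0
  closed : ∀ U V W,
    U (form V W) - V (form U W) + W (form U V)
      - form ⁅U, V⁆ W + form ⁅U, W⁆ V - form ⁅V, W⁆ U = 0
  nondegenerate : Function.Bijective form

variable (𝕜 R) in
/-- The differential `f ↦ df`, with `df` regarded as a linear functional on vector fields. -/
def differential : Derivation 𝕜 R (Module.Dual R (Derivation 𝕜 R R)) :=
  Derivation.mk'
    { toFun := fun f =>
        { toFun := fun V => V f
          map_add' := fun _ _ => rfl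
          map_smul' := fun _ _ => rfl }
      map_add' := fun f g => by ext V; simp
      map_smul' := fun c f => by ext V; simp }
    (fun f g => by ext V; simp)

/-- The Hamiltonian vector field `X_f` of `f`, determined by `ω(X_f, ·) = -df`. -/
def SymplecticForm.hamiltonian (ω : SymplecticForm 𝕜 R) :
    Derivation 𝕜 R (Derivation 𝕜 R R) :=
  (LinearEquiv.ofBijective ω.form ω.nondegenerate).symm.toLinearMap.compDer (-differential 𝕜 R)

/-- The Poisson bracket `{f, g} = X_f(g) = ω(X_f, X_g)` of a symplectic form. -/
def SymplecticForm.bracket (ω : SymplecticForm 𝕜 R) : R →ₗ[𝕜] R →ₗ[𝕜] R :=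
  LinearMap.mk₂ 𝕜 (fun f g => ω.hamiltonian f g)
    (fun _ _ _ => by simp) (fun _ _ _ => by simp) (fun _ _ _ => by simp) (fun _ _ _ => by simp)

/-- The closed subscheme with ideal `J` (assumed smooth) is isotropic: the form vanishes on it.
Vector fields on a smooth closed subscheme of `Spec R` are restrictions of vector fields
on `Spec R` that are tangent to it. -/
def SymplecticForm.IsIsotropic (ω : SymplecticForm 𝕜 R) (J : Ideal R) : Prop :=
  ∀ V W : Derivation 𝕜 R R, (∀ f ∈ J, V f ∈ J) → (∀ f ∈ J, W f ∈ J) → ω.form V W ∈ J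

end Poisson

/-! ## Affine symplectic groupoids, Hamiltonian schemes, stabilizer subgroupoids -/

section Symplectic

/-- An affine symplectic groupoid: an affine algebraic Lie groupoid with a symplectic form on `G`
for which the graph of multiplication is coisotropic in `G × G × G⁻`. -/
structure AffineSymplecticGroupoid (𝕜 : Type u₁) [Field 𝕜]
    (A : Type u₂) [CommRing A] [Algebra 𝕜 A] (B : Type u₃) [CommRing B] [Algebra 𝕜 B] extends
    AffineGroupoid 𝕜 A B where
  isLie : toAffineGroupoid.IsLie
  ω : SymplecticForm 𝕜 B
  multiplicative :
    IsCoisotropic (prodBracket (prodBracket ω.bracket ω.bracket) (-ω.bracket))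
      (graphIdeal src tgt mul)

variable {𝕜 : Type u₁} [Field 𝕜]
  {A : Type u₂} [CommRing A] [Algebra 𝕜 A]
  {B : Type u₃} [CommRing B] [Algebra 𝕜 B]
  {C : Type u₄} [CommRing C] [Algebra 𝕜 C]

/-- An affine `G`-scheme `M` with a Poisson bracket on `𝕜[M]` is Hamiltonian if the graph of the
action is coisotropic in `G × M × M⁻`. -/
def GScheme.IsHamiltonian {G : AffineSymplecticGroupoid 𝕜 A B}
    (M : GScheme G.toAffineGroupoid C) (P : PoissonBracket 𝕜 C) : Prop :=
  IsCoisotropic (prodBracket (prodBracket G.ω.bracket P.bracket) (-P.bracket))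
    (graphIdeal G.src M.moment M.act)

/-- The Poisson bracket on the base `X`. It is the one for which `s : G → X` is anti-Poisson (and
`t : G → X` is Poisson): since `1* ∘ s* = id`, the equation `s*{f, g} = -{s* f, s* g}` forces
`{f, g} = -1*{s* f, s* g}`. -/
def AffineSymplecticGroupoid.baseBracket (G : AffineSymplecticGroupoid 𝕜 A B) :
    A →ₗ[𝕜] A →ₗ[𝕜] A :=
  -((G.ω.bracket.compl₁₂ G.src.toLinearMap G.src.toLinearMap).compr₂ G.unit.toLinearMap)

/-- The contraction `σ : T*X → TX` with the Poisson bivector field of `X`, followed by restriction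
to the closed subscheme `S` with ideal `I`, on sections. A section of `T*X` over `S` is an element
of `𝕜[S] ⊗_{𝕜[X]} Ω_X`; a section of `TX` over `S` is a derivation `𝕜[X] → 𝕜[S]`, here regarded
as a linear map. One has `σ(c ⊗ df) = c · {f, ·}|_S`. -/
def AffineSymplecticGroupoid.sharp (G : AffineSymplecticGroupoid 𝕜 A B) (I : Ideal A) :
    (A ⧸ I) ⊗[A] Ω[A⁄𝕜] →ₗ[A ⧸ I] (A →ₗ[𝕜] A ⧸ I) :=
  LinearMap.liftBaseChange (A ⧸ I) (Derivation.liftKaehlerDifferential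
    (Derivation.mk'
      (G.baseBracket.compr₂ (Ideal.Quotient.mkₐ 𝕜 I).toLinearMap)
      (fun f g => by
        ext h
        have hs : ∀ a, G.unit (G.src a) = a := fun a => DFunLike.congr_fun G.unit_src a
        simp [AffineSymplecticGroupoid.baseBracket, SymplecticForm.bracket, hs,
          Algebra.smul_def]
        ring)))

/-- The isomorphism `T*X → Lie(G)` of vector bundles on `X`, restricted to the closed subscheme `S`
with ideal `I`, on sections. The Lie algebroid of `G` consists of the tangent vectors to the source
fibres at the units, and the isomorphism sends `df` to the restriction to the units of the
Hamiltonian vector field of `t* f`; up to sign it is inverse to `v ↦ ω(v, ·)|_{TX}`.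
A section over `S` of the tangent bundle of `G` along the units is a derivation `𝕜[G] → 𝕜[S]`,
here regarded as a linear map. -/
def AffineSymplecticGroupoid.cotangentToLie (G : AffineSymplecticGroupoid 𝕜 A B) (I : Ideal A) :
    (A ⧸ I) ⊗[A] Ω[A⁄𝕜] →ₗ[A ⧸ I] (B →ₗ[𝕜] A ⧸ I) :=
  LinearMap.liftBaseChange (A ⧸ I) (Derivation.liftKaehlerDifferential
    (Derivation.mk'
      ((G.ω.bracket.comp G.tgt.toLinearMap).compr₂
        ((Ideal.Quotient.mkₐ 𝕜 I).comp G.unit).toLinearMap)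
      (fun f g => by
        ext h
        have ht : ∀ a, G.unit (G.tgt a) = a := fun a => DFunLike.congr_fun G.unit_tgt a
        simp [SymplecticForm.bracket, ht, Algebra.smul_def])))

variable (𝕜) in
/-- The conormal bundle `N*_S X ⊆ T*X|_S`, on sections: the covectors that pull back to zero
on `S`. -/
def conormal (I : Ideal A) : Submodule (A ⧸ I) ((A ⧸ I) ⊗[A] Ω[A⁄𝕜]) :=
  LinearMap.ker (KaehlerDifferential.mapBaseChange 𝕜 A (A ⧸ I))

/-- `σ⁻¹(TS) ⊆ T*X|_S`, on sections: a vector field along `S` is tangent to `S` if it annihilates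
the ideal of `S`. -/
def AffineSymplecticGroupoid.sharpPreimageTangent (G : AffineSymplecticGroupoid 𝕜 A B)
    (I : Ideal A) : Submodule (A ⧸ I) ((A ⧸ I) ⊗[A] Ω[A⁄𝕜]) where
  carrier := {α | ∀ f ∈ I, G.sharp I α f = 0}
  add_mem' := fun ha hb f hf => by simp [ha f hf, hb f hf]
  zero_mem' := fun f _ => by simp
  smul_mem' := fun c α ha f hf => by simp [ha f hf]

/-- The Lie algebroid of a closed subgroupoid `H ⇉ S`, on sections, inside the restriction to `S` of
the Lie algebroid of `G`: the derivations `D : 𝕜[H] → 𝕜[S]` along the units which annihilate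
functions pulled back by the source map, each viewed on `𝕜[G]` by composing with the restriction
`𝕜[G] → 𝕜[H]`. -/
def ClosedSubgroupoid.lieAlgebroid {G : AffineGroupoid 𝕜 A B} {I : Ideal A} {J : Ideal B}
    (H : ClosedSubgroupoid G I J) : Submodule (A ⧸ I) (B →ₗ[𝕜] A ⧸ I) where
  carrier := {v | ∃ D : B ⧸ J →ₗ[𝕜] A ⧸ I,
    (∀ f g, D (f * g) = H.unit f * D g + H.unit g * D f) ∧
    (∀ a, D (H.src a) = 0) ∧
    v = D ∘ₗ (Ideal.Quotient.mkₐ 𝕜 J).toLinearMap}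
  add_mem' := by
    rintro _ _ ⟨D, hD, hs, rfl⟩ ⟨E, hE, ht, rfl⟩
    refine ⟨D + E, fun f g => ?_, fun a => ?_, rfl⟩
    · simp only [LinearMap.add_apply, hD, hE]; ring
    · simp [hs, ht]
  zero_mem' := ⟨0, by simp, by simp, rfl⟩
  smul_mem' := by
    rintro c _ ⟨D, hD, hs, rfl⟩
    refine ⟨c • D, fun f g => ?_, fun a => ?_, rfl⟩
    · simp only [LinearMap.smul_apply, hD, smul_eq_mul]; ring
    · simp [hs]

/-- `H ⇉ S` is a stabilizer subgroupoid of `G ⇉ X`: it is an affine algebraic Lie groupoid (so that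
`H` and `S` are smooth), `H` is isotropic in `G`, and the Lie algebroid of `H` is
`N*_S X ∩ σ⁻¹(TS)` under the identification of `T*X` with the Lie algebroid of `G`. -/
structure IsStabilizer (G : AffineSymplecticGroupoid 𝕜 A B) {I : Ideal A} {J : Ideal B}
    (H : ClosedSubgroupoid G.toAffineGroupoid I J) : Prop where
  isLie : H.toAffineGroupoid.IsLie
  isotropic : G.ω.IsIsotropic J
  lieAlgebroid_eq : H.lieAlgebroid =
    (conormal 𝕜 I ⊓ G.sharpPreimageTangent I).map (G.cotangentToLie I)

end Symplectic

end CoisotropicReduction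

end

/-!
The bracket of two invariant functions on `μ⁻¹(S)` is computed by extending them to `M`. Three things
have to be seen: the restricted bracket does not depend on the extensions, it is again invariant, and
the Poisson axioms and uniqueness are inherited, the latter because `j*` is surjective.

Coisotropy of the graph of the action says that `𝒜*{f, g}` is the restriction to `G ×_X M` of the
bracket on `G × M` of arbitrary extensions of `𝒜*f` and `𝒜*g` (`proj_prodBracket`).

*Independence of the extensions.* It follows that `{μ*a, ·}` is the infinitesimal action of the
section of the Lie algebroid given by `da` (`GScheme.bracket_moment`). As `S` is coisotropic, this is
a section of the Lie algebroid of `H` for `a = i` in the ideal of `S`, and therefore `{μ*i, f}`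
vanishes on `μ⁻¹(S)` if `j*f` is invariant (`IsStabilizer.restrict_bracket_moment`).

*Invariance.* If `j*f` is invariant, `𝒜*f` has an extension to `G × M` of the form `1 ⊗ f + α` with
`α` vanishing on `H × M`. If `H` is coisotropic in `G`, then the bracket of two such extensions is
again of this form, so `j*{f, g}` is invariant (`IsStabilizer.restrict_bracket_mem`).

*`H` is coisotropic* (`IsStabilizer.isCoisotropic`). This replaces a count of dimensions, which
would show that the isotropic `H` is Lagrangian, by an argument with sections. The units of `G` are
coisotropic (`AffineSymplecticGroupoid.unit_bracket`), hence `ker dt` is spanned along the units,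
and by left translation everywhere, by the Hamiltonian vector fields of the functions `s*a`
(`AffineSymplecticGroupoid.exists_eq_sum_bracket_src`). Now let `f` vanish on `H`. For `i` in the
ideal of `S` the Hamiltonian vector fields of `t*i` and `s*i` are tangent to `H`. Hence `dt` maps
`X_f|_H` to `TS`, and, `t : H → S` being smooth, `X_f|_H = W + ∑ c_k X_{s*a_k}` with `W` tangent to
`H`. As `X_f` and, by isotropy, `W` are orthogonal to `TH`, the covector `∑ c_k da_k` annihilates the
projections under `ds` of vector fields tangent to `H`. If `b` vanishes on `H`, then, `s : H → S`
being smooth, `X_b` has the same projection as a field tangent to `H`, and so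
`∑ c_k {s*a_k, b} = 0` on `H`, i.e. `{f, b} = 0` on `H`.
-/

noncomputable section

namespace CoisotropicReduction

universe u₁ u₂ u₃ u₄ u₅

/-! ### Fibre products -/

section FibreProductLemmas

variable {𝕜 : Type u₁} [Field 𝕜]
  {A : Type u₂} [CommRing A] [Algebra 𝕜 A]
  {B : Type u₃} [CommRing B] [Algebra 𝕜 B]
  {C : Type u₄} [CommRing C] [Algebra 𝕜 C]
  {D : Type u₅} [CommRing D] [Algebra 𝕜 D]
  {f : A →ₐ[𝕜] B} {g : A →ₐ[𝕜] C}

theorem Fib.proj_surjective (f : A →ₐ[𝕜] B) (g : A →ₐ[𝕜] C) :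
    Function.Surjective (Fib.proj f g) :=
  Ideal.Quotient.mk_surjective

theorem Fib.proj_eq_zero_iff {x : B ⊗[𝕜] C} : Fib.proj f g x = 0 ↔ x ∈ fibIdeal f g :=
  Ideal.Quotient.eq_zero_iff_mem

theorem Fib.proj_tmul (b : B) (c : C) :
    Fib.proj f g (b ⊗ₜ c) = Fib.inl f g b * Fib.inr f g c := by
  simp [Fib.inl, Fib.inr, ← map_mul]

theorem Fib.proj_tmul_one (b : B) : Fib.proj f g (b ⊗ₜ 1) = Fib.inl f g b := rfl

theorem Fib.proj_one_tmul (c : C) : Fib.proj f g (1 ⊗ₜ c) = Fib.inr f g c := rfl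

theorem Fib.inl_apply_eq (a : A) : Fib.inl f g (f a) = Fib.inr f g (g a) :=
  DFunLike.congr_fun (Fib.condition f g) a

theorem Fib.lift_proj (u : B →ₐ[𝕜] D) (v : C →ₐ[𝕜] D) (h : u.comp f = v.comp g)
    (x : B ⊗[𝕜] C) :
    Fib.lift f g u v h (Fib.proj f g x) = Algebra.TensorProduct.productMap u v x := rfl

theorem Fib.lift_inl (u : B →ₐ[𝕜] D) (v : C →ₐ[𝕜] D) (h : u.comp f = v.comp g) (b : B) :
    Fib.lift f g u v h (Fib.inl f g b) = u b :=
  DFunLike.congr_fun (Fib.lift_comp_inl f g u v h) b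

theorem Fib.lift_inr (u : B →ₐ[𝕜] D) (v : C →ₐ[𝕜] D) (h : u.comp f = v.comp g) (c : C) :
    Fib.lift f g u v h (Fib.inr f g c) = v c :=
  DFunLike.congr_fun (Fib.lift_comp_inr f g u v h) c

theorem Fib.hom_ext {φ ψ : Fib f g →ₐ[𝕜] D}
    (hl : ∀ b, φ (Fib.inl f g b) = ψ (Fib.inl f g b))
    (hr : ∀ c, φ (Fib.inr f g c) = ψ (Fib.inr f g c)) : φ = ψ := by
  refine AlgHom.ext fun y => ?_
  obtain ⟨x, rfl⟩ := Fib.proj_surjective f g y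
  induction x with
  | zero => simp
  | tmul b c => simp only [Fib.proj_tmul, map_mul, hl, hr]
  | add x y hx hy => simp only [map_add, hx, hy]

theorem Fib.lift_congr {u u' : B →ₐ[𝕜] D} {v v' : C →ₐ[𝕜] D} (hu : u = u') (hv : v = v')
    (h : u.comp f = v.comp g) (h' : u'.comp f = v'.comp g) :
    Fib.lift f g u v h = Fib.lift f g u' v' h' := by
  subst hu hv; rfl

theorem Fib.comp_lift {E : Type*} [CommRing E] [Algebra 𝕜 E] (φ : D →ₐ[𝕜] E)
    (u : B →ₐ[𝕜] D) (v : C →ₐ[𝕜] D) (h : u.comp f = v.comp g) :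
    φ.comp (Fib.lift f g u v h) = Fib.lift f g (φ.comp u) (φ.comp v)
      (by rw [AlgHom.comp_assoc, h, AlgHom.comp_assoc]) :=
  Fib.hom_ext (fun b => by simp [Fib.lift_inl]) (fun c => by simp [Fib.lift_inr])

/-- A linear map on `B ⊗ C` that is balanced over `A` descends to `B ⊗_A C`. -/
theorem Fib.eq_of_balanced {N : Type*} [AddCommGroup N] [Module 𝕜 N] (L : B ⊗[𝕜] C →ₗ[𝕜] N)
    (hL : ∀ a b c, L ((f a * b) ⊗ₜ c) = L (b ⊗ₜ (g a * c))) {x y : B ⊗[𝕜] C}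
    (hxy : Fib.proj f g x = Fib.proj f g y) : L x = L y := by
  have key : ∀ z ∈ fibIdeal f g, ∀ y, L (y * z) = 0 := by
    intro z hz
    induction hz using Submodule.span_induction with
    | mem z hz =>
      obtain ⟨a, rfl⟩ := hz
      intro y
      induction y with
      | zero => simp
      | tmul b c =>
        simp only [mul_sub, Algebra.TensorProduct.tmul_mul_tmul, mul_one, map_sub]
        rw [mul_comm b, mul_comm c, hL, sub_self]
      | add x y hx hy => rw [add_mul, map_add, hx, hy, add_zero]
    | zero => simp
    | add x y _ _ hx hy => intro z; rw [mul_add, map_add, hx, hy, add_zero]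
    | smul c x _ hx => intro y; rw [smul_eq_mul, ← mul_assoc, hx]
  have := key (x - y) (Fib.proj_eq_zero_iff.mp (by rw [map_sub, hxy, sub_self])) 1
  rwa [one_mul, map_sub, sub_eq_zero] at this

theorem mem_map_of_inr_eq_zero (I : Ideal A) (g : A →ₐ[𝕜] C) {c : C}
    (hc : Fib.inr (Ideal.Quotient.mkₐ 𝕜 I) g c = 0) : c ∈ I.map g := by
  let φ : A ⧸ I →ₐ[𝕜] C ⧸ I.map g := Ideal.quotientMapₐ _ g Ideal.le_comap_map
  have h : φ.comp (Ideal.Quotient.mkₐ 𝕜 I) = (Ideal.Quotient.mkₐ 𝕜 (I.map g)).comp g := by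
    ext a; rfl
  have := Fib.lift_inr φ (Ideal.Quotient.mkₐ 𝕜 (I.map g)) h c
  rw [hc, map_zero] at this
  exact Ideal.Quotient.eq_zero_iff_mem.mp this.symm

theorem Fib.inr_mk_surjective (I : Ideal A) (g : A →ₐ[𝕜] C) :
    Function.Surjective (Fib.inr (Ideal.Quotient.mkₐ 𝕜 I) g) := by
  intro y
  obtain ⟨x, rfl⟩ := Fib.proj_surjective _ _ y
  induction x with
  | zero => exact ⟨0, by simp⟩
  | tmul b c =>
    obtain ⟨a, rfl⟩ := Ideal.Quotient.mk_surjective b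
    refine ⟨g a * c, ?_⟩
    rw [Fib.proj_tmul, map_mul, ← Fib.inl_apply_eq]
    rfl
  | add x y hx hy =>
    obtain ⟨a, ha⟩ := hx
    obtain ⟨b, hb⟩ := hy
    exact ⟨a + b, by rw [map_add, map_add, ha, hb]⟩

end FibreProductLemmas

/-! ### Brackets on tensor products and coisotropic graphs -/

section Brackets

variable {𝕜 : Type u₁} [Field 𝕜]
  {A : Type u₂} [CommRing A] [Algebra 𝕜 A]
  {B : Type u₃} [CommRing B] [Algebra 𝕜 B]
  {C : Type u₄} [CommRing C] [Algebra 𝕜 C]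
  {D : Type u₅} [CommRing D] [Algebra 𝕜 D]

/-- An antisymmetric biderivation of a commutative algebra, i.e. a bivector field: a Poisson bracket
without the Jacobi identity. -/
structure IsBivector (P : B →ₗ[𝕜] B →ₗ[𝕜] B) : Prop where
  antisymm : ∀ a b, P a b = -P b a
  leibniz : ∀ a b c, P a (b * c) = P a b * c + b * P a c

theorem IsBivector.apply_one {P : B →ₗ[𝕜] B →ₗ[𝕜] B} (hP : IsBivector P) (a : B) : P a 1 = 0 := by
  simpa using hP.leibniz a 1 1

theorem IsBivector.one_apply {P : B →ₗ[𝕜] B →ₗ[𝕜] B} (hP : IsBivector P) (a : B) : P 1 a = 0 := by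
  rw [hP.antisymm, hP.apply_one, neg_zero]

theorem PoissonBracket.isBivector (P : PoissonBracket 𝕜 B) : IsBivector P.bracket where
  antisymm a b := by
    have h := P.bracket_self (a + b)
    simp only [map_add, LinearMap.add_apply, P.bracket_self, zero_add, add_zero] at h
    exact eq_neg_of_add_eq_zero_right h
  leibniz := P.leibniz

theorem SymplecticForm.form_hamiltonian (ω : SymplecticForm 𝕜 B) (f : B)
    (V : Derivation 𝕜 B B) : ω.form (ω.hamiltonian f) V = -V f := by
  have h : ω.form (ω.hamiltonian f) = (-differential 𝕜 B) f :=
    (LinearEquiv.ofBijective ω.form ω.nondegenerate).apply_symm_apply _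
  rw [h]
  rfl

theorem SymplecticForm.form_antisymm (ω : SymplecticForm 𝕜 B) (V W : Derivation 𝕜 B B) :
    ω.form V W = -ω.form W V := by
  have h := ω.alternating (V + W)
  simp only [map_add, LinearMap.add_apply, ω.alternating, zero_add, add_zero] at h
  exact eq_neg_of_add_eq_zero_right h

theorem SymplecticForm.isBivector (ω : SymplecticForm 𝕜 B) : IsBivector ω.bracket where
  antisymm a b := by
    change ω.hamiltonian a b = -ω.hamiltonian b a
    have h := ω.form_antisymm (ω.hamiltonian a) (ω.hamiltonian b)
    rw [ω.form_hamiltonian, ω.form_hamiltonian, neg_neg] at h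
    exact h.symm
  leibniz a b c := by
    change ω.hamiltonian a (b * c) = ω.hamiltonian a b * c + b * ω.hamiltonian a c
    rw [Derivation.leibniz, smul_eq_mul, smul_eq_mul]
    ring

theorem prodBracket_tmul (P : B →ₗ[𝕜] B →ₗ[𝕜] B) (Q : C →ₗ[𝕜] C →ₗ[𝕜] C) (b b' : B) (c c' : C) :
    prodBracket P Q (b ⊗ₜ c) (b' ⊗ₜ c') = P b b' ⊗ₜ (c * c') + (b * b') ⊗ₜ Q c c' := rfl

variable {P : B →ₗ[𝕜] B →ₗ[𝕜] B} {Q : C →ₗ[𝕜] C →ₗ[𝕜] C} {S : D →ₗ[𝕜] D →ₗ[𝕜] D}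

theorem prodBracket_apply_one (hP : IsBivector P) (hQ : IsBivector Q) (x : B ⊗[𝕜] C) :
    prodBracket P Q x 1 = 0 := by
  induction x with
  | zero => simp
  | tmul b c =>
    rw [Algebra.TensorProduct.one_def, prodBracket_tmul, hP.apply_one, hQ.apply_one]
    simp
  | add x y hx hy => rw [map_add, LinearMap.add_apply, hx, hy, add_zero]

theorem prodBracket_one_apply (hP : IsBivector P) (hQ : IsBivector Q) (x : B ⊗[𝕜] C) :
    prodBracket P Q 1 x = 0 := by
  induction x with
  | zero => simp
  | tmul b c =>
    rw [Algebra.TensorProduct.one_def, prodBracket_tmul, hP.one_apply, hQ.one_apply]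
    simp
  | add x y hx hy => rw [map_add, hx, hy, add_zero]

/-- If the graph of a morphism `a : Y ×_X Z → W` is coisotropic in `Y × Z × W⁻`, then the bracket on
`Y × Z` of extensions of `a*d` and `a*e` extends `a*{d, e}`. -/
theorem proj_prodBracket {f : A →ₐ[𝕜] B} {g : A →ₐ[𝕜] C} {a : D →ₐ[𝕜] Fib f g}
    (hP : IsBivector P) (hQ : IsBivector Q) (hS : IsBivector S)
    (h : IsCoisotropic (prodBracket (prodBracket P Q) (-S)) (graphIdeal f g a))
    {x y : B ⊗[𝕜] C} {d e : D} (hx : Fib.proj f g x = a d) (hy : Fib.proj f g y = a e) :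
    Fib.proj f g (prodBracket P Q x y) = a (S d e) := by
  have mem : ∀ {z : B ⊗[𝕜] C} {c : D}, Fib.proj f g z = a c →
      z ⊗ₜ[𝕜] (1 : D) - (1 : B ⊗[𝕜] C) ⊗ₜ[𝕜] c ∈ graphIdeal f g a := by
    intro z c hz
    rw [graphIdeal, RingHom.mem_ker]
    simp [hz]
  have := h _ (mem hx) _ (mem hy)
  simp only [map_sub, LinearMap.sub_apply, prodBracket_tmul, prodBracket_apply_one hP hQ,
    prodBracket_one_apply hP hQ, LinearMap.neg_apply, hS.apply_one, hS.one_apply] at this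
  rw [graphIdeal, RingHom.mem_ker] at this
  simpa [sub_eq_zero, ← sub_eq_add_neg] using this

end Brackets

/-! ### Hamiltonian vector fields of functions pulled back from the base -/

section Translation

variable {𝕜 : Type u₁} [Field 𝕜]
  {A : Type u₂} [CommRing A] [Algebra 𝕜 A]
  {B : Type u₃} [CommRing B] [Algebra 𝕜 B]
  {C : Type u₄} [CommRing C] [Algebra 𝕜 C]
  {D : Type u₅} [CommRing D] [Algebra 𝕜 D]

/-- The linear map `b ⊗ c ↦ u b * v c`. -/
def productLinear (u : B →ₗ[𝕜] D) (v : C →ₗ[𝕜] D) : B ⊗[𝕜] C →ₗ[𝕜] D :=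
  LinearMap.mul' 𝕜 D ∘ₗ TensorProduct.map u v

@[simp]
theorem productLinear_tmul (u : B →ₗ[𝕜] D) (v : C →ₗ[𝕜] D) (b : B) (c : C) :
    productLinear u v (b ⊗ₜ c) = u b * v c := rfl

theorem AffineGroupoid.unit_src_apply (G : AffineGroupoid 𝕜 A B) (a : A) :
    G.unit (G.src a) = a := DFunLike.congr_fun G.unit_src a

theorem AffineGroupoid.unit_tgt_apply (G : AffineGroupoid 𝕜 A B) (a : A) :
    G.unit (G.tgt a) = a := DFunLike.congr_fun G.unit_tgt a

theorem AffineGroupoid.mul_src_apply (G : AffineGroupoid 𝕜 A B) (a : A) :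
    G.mul (G.src a) = Fib.inr G.src G.tgt (G.src a) := DFunLike.congr_fun G.mul_src a

theorem AffineGroupoid.mul_tgt_apply (G : AffineGroupoid 𝕜 A B) (a : A) :
    G.mul (G.tgt a) = Fib.inl G.src G.tgt (G.tgt a) := DFunLike.congr_fun G.mul_tgt a

/-- The left unit law, for an extension `F` of `m*b` to `G × G`. -/
theorem AffineGroupoid.productMap_tgt_unit (G : AffineGroupoid 𝕜 A B) {F : B ⊗[𝕜] B} {b : B}
    (hF : Fib.proj G.src G.tgt F = G.mul b) :
    Algebra.TensorProduct.productMap (G.tgt.comp G.unit) (AlgHom.id 𝕜 B) F = b := by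
  have h := DFunLike.congr_fun G.one_mul b
  rwa [AlgHom.comp_apply, ← hF, Fib.lift_proj] at h

/-- The right unit law, for an extension `F` of `m*b` to `G × G`. -/
theorem AffineGroupoid.productMap_src_unit (G : AffineGroupoid 𝕜 A B) {F : B ⊗[𝕜] B} {b : B}
    (hF : Fib.proj G.src G.tgt F = G.mul b) :
    Algebra.TensorProduct.productMap (AlgHom.id 𝕜 B) (G.src.comp G.unit) F = b := by
  have h := DFunLike.congr_fun G.mul_one b
  rwa [AlgHom.comp_apply, ← hF, Fib.lift_proj] at h

theorem AffineGroupoid.mul_injective (G : AffineGroupoid 𝕜 A B) : Function.Injective G.mul :=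
  Function.LeftInverse.injective (DFunLike.congr_fun G.one_mul)

/-- The action of a groupoid on its arrows by left multiplication. -/
def AffineGroupoid.regular (G : AffineGroupoid 𝕜 A B) : GScheme G B where
  moment := G.tgt
  act := G.mul
  act_moment := G.mul_tgt
  act_one := G.one_mul
  act_mul := G.mul_assoc

/-- The unit law of an action, for an extension `F` of `𝒜*c` to `G × M`. -/
theorem GScheme.productMap_moment_unit {G : AffineGroupoid 𝕜 A B} (M : GScheme G C)
    {F : B ⊗[𝕜] C} {c : C} (hF : Fib.proj G.src M.moment F = M.act c) :
    Algebra.TensorProduct.productMap (M.moment.comp G.unit) (AlgHom.id 𝕜 C) F = c := by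
  have h := DFunLike.congr_fun M.act_one c
  rwa [AlgHom.comp_apply, ← hF, Fib.lift_proj] at h

variable (G : AffineSymplecticGroupoid 𝕜 A B)

theorem AffineSymplecticGroupoid.bracket_src_tgt (a b : A) :
    G.ω.bracket (G.src a) (G.tgt b) = 0 := by
  apply G.mul_injective
  rw [← proj_prodBracket G.ω.isBivector G.ω.isBivector G.ω.isBivector G.multiplicative
    (x := 1 ⊗ₜ G.src a) (y := G.tgt b ⊗ₜ 1) (G.mul_src_apply a).symm (G.mul_tgt_apply b).symm,
    prodBracket_tmul, G.ω.isBivector.one_apply, G.ω.isBivector.apply_one]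
  simp

/-- The linear functional `b ↦ 1*{t*a, b}`: the section of the Lie algebroid that corresponds
to `da`. -/
def AffineSymplecticGroupoid.lieSection (a : A) : B →ₗ[𝕜] A :=
  G.unit.toLinearMap ∘ₗ G.ω.bracket (G.tgt a)

theorem AffineSymplecticGroupoid.lieSection_apply (a : A) (b : B) :
    G.lieSection a b = G.unit (G.ω.bracket (G.tgt a) b) := rfl

/-- The Hamiltonian vector field of `μ*a` is the infinitesimal action of `da`. -/
theorem GScheme.bracket_moment {G : AffineSymplecticGroupoid 𝕜 A B}
    (M : GScheme G.toAffineGroupoid C) {P : C →ₗ[𝕜] C →ₗ[𝕜] C} (hP : IsBivector P)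
    (hM : IsCoisotropic (prodBracket (prodBracket G.ω.bracket P) (-P))
      (graphIdeal G.src M.moment M.act))
    (a : A) {c : C} {F : B ⊗[𝕜] C} (hF : Fib.proj G.src M.moment F = M.act c) :
    P (M.moment a) c =
      productLinear (M.moment.toLinearMap ∘ₗ G.lieSection a) LinearMap.id F := by
  have ha : Fib.proj G.src M.moment (G.tgt a ⊗ₜ 1) = M.act (M.moment a) :=
    (DFunLike.congr_fun M.act_moment a).symm
  have h := proj_prodBracket G.ω.isBivector hP hP hM ha hF
  rw [← M.productMap_moment_unit h]
  clear h hF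
  induction F with
  | zero => simp
  | tmul x y =>
    rw [prodBracket_tmul, hP.one_apply]
    simp [AffineSymplecticGroupoid.lieSection]
  | add x y hx hy => rw [map_add, map_add, hx, hy, map_add]

/-- The Hamiltonian vector field of `s*a` is invariant under left translations, hence determined by
its restriction to the units. -/
theorem AffineSymplecticGroupoid.bracket_src (a : A) {b : B} {F : B ⊗[𝕜] B}
    (hF : Fib.proj G.src G.tgt F = G.mul b) :
    G.ω.bracket (G.src a) b =
      productLinear LinearMap.id
        (G.src.toLinearMap ∘ₗ G.unit.toLinearMap ∘ₗ G.ω.bracket (G.src a)) F := by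
  have h := proj_prodBracket G.ω.isBivector G.ω.isBivector G.ω.isBivector G.multiplicative
    (x := 1 ⊗ₜ G.src a) (G.mul_src_apply a).symm hF
  rw [← G.productMap_src_unit h]
  clear h hF
  induction F with
  | zero => simp
  | tmul x y =>
    rw [prodBracket_tmul, G.ω.isBivector.one_apply]
    simp
  | add x y hx hy => rw [map_add, map_add, hx, hy, map_add]

end Translation

/-! ### The units are coisotropic -/

section Units

variable {𝕜 : Type u₁} [Field 𝕜]
  {A : Type u₂} [CommRing A] [Algebra 𝕜 A]
  {B : Type u₃} [CommRing B] [Algebra 𝕜 B]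

/-- The projection `(1 - p) ⊗ (1 - p')` onto the products of functions that vanish on the units, where
`p` and `p'` are the pullbacks along `g ↦ 1_{s(g)}` and `h ↦ 1_{t(h)}`. -/
def AffineGroupoid.normalPart (G : AffineGroupoid 𝕜 A B) : B ⊗[𝕜] B →ₗ[𝕜] B ⊗[𝕜] B :=
  TensorProduct.map (LinearMap.id - (G.src.comp G.unit).toLinearMap)
    (LinearMap.id - (G.tgt.comp G.unit).toLinearMap)

/-- For `f` vanishing on the units, `m*f` agrees with `f ⊗ 1 + 1 ⊗ f` up to a function that vanishes
to second order along the pairs of units. -/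
theorem AffineGroupoid.proj_normalPart (G : AffineGroupoid 𝕜 A B) {F : B ⊗[𝕜] B} {f : B}
    (hF : Fib.proj G.src G.tgt F = G.mul f) (hf : G.unit f = 0) :
    Fib.proj G.src G.tgt (f ⊗ₜ 1 + 1 ⊗ₜ f + G.normalPart F) = G.mul f := by
  have key : ∀ F : B ⊗[𝕜] B, Fib.proj G.src G.tgt (G.normalPart F) =
      Fib.proj G.src G.tgt F
        - Fib.inr G.src G.tgt
          (Algebra.TensorProduct.productMap (G.tgt.comp G.unit) (AlgHom.id 𝕜 B) F)
        - Fib.inl G.src G.tgt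
          (Algebra.TensorProduct.productMap (AlgHom.id 𝕜 B) (G.src.comp G.unit) F)
        + Fib.inl G.src G.tgt (G.src (G.unit
          (Algebra.TensorProduct.productMap (AlgHom.id 𝕜 B) (G.src.comp G.unit) F))) := by
    intro F
    induction F with
    | zero => simp
    | tmul x y =>
      simp only [normalPart, TensorProduct.map_tmul, LinearMap.sub_apply, LinearMap.id_apply,
        AlgHom.toLinearMap_apply, AlgHom.comp_apply, Fib.proj_tmul, map_sub, map_mul,
        Algebra.TensorProduct.productMap_apply_tmul, AlgHom.id_apply, G.unit_src_apply,
        ← Fib.inl_apply_eq]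
      ring
    | add x y hx hy =>
      simp only [map_add, hx, hy]
      ring
  rw [map_add, map_add, key, G.productMap_tgt_unit hF, G.productMap_src_unit hF, hf, hF,
    Fib.proj_tmul_one, Fib.proj_one_tmul, map_zero, map_zero]
  ring

variable (G : AffineSymplecticGroupoid 𝕜 A B)

/-- The units form a coisotropic subvariety. For `f` and `g` vanishing on the units, restricting
`m*{f, g}` to the pairs of units gives `{f, g}`, but also `2{f, g}`, since
`m*f ≡ f ⊗ 1 + 1 ⊗ f` to first order. -/
theorem AffineSymplecticGroupoid.unit_bracket {f g : B} (hf : G.unit f = 0) (hg : G.unit g = 0) :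
    G.unit (G.ω.bracket f g) = 0 := by
  obtain ⟨F, hF⟩ := Fib.proj_surjective G.src G.tgt (G.mul f)
  obtain ⟨K, hK⟩ := Fib.proj_surjective G.src G.tgt (G.mul g)
  have hω := G.ω.isBivector
  have h := proj_prodBracket hω hω hω G.multiplicative (G.proj_normalPart hF hf)
    (G.proj_normalPart hK hg)
  let ε := Algebra.TensorProduct.productMap (R := 𝕜) G.unit G.unit
  have hε : ∀ x, G.unit (Algebra.TensorProduct.productMap (G.tgt.comp G.unit)
      (AlgHom.id 𝕜 B) x) = ε x := by
    intro x
    induction x with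
    | zero => simp
    | tmul x y => simp [ε, G.unit_tgt_apply]
    | add x y hx hy => simp only [map_add, hx, hy]
  have left : ∀ x y, ε (prodBracket G.ω.bracket G.ω.bracket (G.normalPart x) y) = 0 := by
    intro x y
    induction x with
    | zero => simp
    | add x y hx hy => simp only [map_add, LinearMap.add_apply, hx, hy, add_zero]
    | tmul x x' =>
      induction y with
      | zero => simp
      | add x y hx hy => simp only [map_add, hx, hy, add_zero]
      | tmul y y' =>
        simp [AffineGroupoid.normalPart, prodBracket_tmul, ε, G.unit_src_apply, G.unit_tgt_apply]
  have right : ∀ x y, ε (prodBracket G.ω.bracket G.ω.bracket x (G.normalPart y)) = 0 := by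
    intro x y
    induction x with
    | zero => simp
    | add x y hx hy => simp only [map_add, LinearMap.add_apply, hx, hy, add_zero]
    | tmul x x' =>
      induction y with
      | zero => simp
      | add x y hx hy => simp only [map_add, hx, hy, add_zero]
      | tmul y y' =>
        simp [AffineGroupoid.normalPart, prodBracket_tmul, ε, G.unit_src_apply, G.unit_tgt_apply]
  have h2 := hε (prodBracket G.ω.bracket G.ω.bracket (f ⊗ₜ 1 + 1 ⊗ₜ f + G.normalPart F)
    (g ⊗ₜ 1 + 1 ⊗ₜ g + G.normalPart K))
  rw [G.productMap_tgt_unit h] at h2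
  simp only [map_add, LinearMap.add_apply, left, right, prodBracket_tmul, hω.apply_one,
    hω.one_apply] at h2
  simpa [ε] using h2

end Units

/-! ### The infinitesimal action of the stabilizer subgroupoid -/

section InfinitesimalAction

variable {𝕜 : Type u₁} [Field 𝕜]
  {A : Type u₂} [CommRing A] [Algebra 𝕜 A]
  {B : Type u₃} [CommRing B] [Algebra 𝕜 B]
  {C : Type u₄} [CommRing C] [Algebra 𝕜 C]

/-- A section of the Lie algebroid of a groupoid: a vector field along the units, tangent to the
fibres of the source map. -/
structure AffineGroupoid.IsLieSection (G : AffineGroupoid 𝕜 A B) (D : B →ₗ[𝕜] A) : Prop where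
  leibniz : ∀ f g, D (f * g) = G.unit f * D g + G.unit g * D f
  apply_src : ∀ a, D (G.src a) = 0

theorem AffineGroupoid.IsLieSection.apply_one {G : AffineGroupoid 𝕜 A B} {D : B →ₗ[𝕜] A}
    (hD : G.IsLieSection D) : D 1 = 0 := by
  rw [← map_one G.src, hD.apply_src]

/-- The infinitesimal action of a section of the Lie algebroid annihilates invariant functions. -/
theorem AffineGroupoid.IsLieSection.productLinear_eq_zero {G : AffineGroupoid 𝕜 A B}
    {D : B →ₗ[𝕜] A} (hD : G.IsLieSection D) (ν : A →ₐ[𝕜] C) {x : B ⊗[𝕜] C} {c : C}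
    (hx : Fib.proj G.src ν x = Fib.inr G.src ν c) :
    productLinear (ν.toLinearMap ∘ₗ D) LinearMap.id x = 0 := by
  rw [Fib.eq_of_balanced _ _ (hx.trans (Fib.proj_one_tmul c).symm)]
  · simp [hD.apply_one]
  · intro a b c
    simp only [productLinear_tmul, LinearMap.comp_apply, AlgHom.toLinearMap_apply, hD.leibniz,
      hD.apply_src, G.unit_src_apply, LinearMap.id_apply, map_mul, mul_zero, add_zero]
    ring

/-- Subtracting from `D` its component tangent to the units gives a vector field `D - D ∘ t* ∘ 1*`
along the units that is tangent to the fibres of the target map, so that the left-invariant vector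
field which it generates is well defined on `G ×_X G`. -/
theorem AffineGroupoid.IsLieSection.productLinear_left_eq_zero {G : AffineGroupoid 𝕜 A B}
    {D : B →ₗ[𝕜] A} (hD : G.IsLieSection D) {x : B ⊗[𝕜] B}
    (hx : Fib.proj G.src G.tgt x = 0) :
    productLinear LinearMap.id (G.src.toLinearMap ∘ₗ
      (D - D ∘ₗ G.tgt.toLinearMap ∘ₗ G.unit.toLinearMap)) x = 0 := by
  rw [Fib.eq_of_balanced _ _ (hx.trans (map_zero _).symm), map_zero]
  intro a b c
  simp only [productLinear_tmul, LinearMap.comp_apply, AlgHom.toLinearMap_apply,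
    LinearMap.sub_apply, hD.leibniz, G.unit_tgt_apply, LinearMap.id_apply, map_add, map_mul,
    map_sub]
  ring

variable {I : Ideal A} {J : Ideal B}

theorem ClosedSubgroupoid.src_mk {G : AffineGroupoid 𝕜 A B} (H : ClosedSubgroupoid G I J) (a : A) :
    H.src (Ideal.Quotient.mk I a) = Ideal.Quotient.mk J (G.src a) :=
  (DFunLike.congr_fun H.incl_src a).symm

theorem ClosedSubgroupoid.tgt_mk {G : AffineGroupoid 𝕜 A B} (H : ClosedSubgroupoid G I J) (a : A) :
    H.tgt (Ideal.Quotient.mk I a) = Ideal.Quotient.mk J (G.tgt a) :=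
  (DFunLike.congr_fun H.incl_tgt a).symm

theorem ClosedSubgroupoid.unit_mk {G : AffineGroupoid 𝕜 A B} (H : ClosedSubgroupoid G I J)
    (b : B) : H.unit (Ideal.Quotient.mk J b) = Ideal.Quotient.mk I (G.unit b) :=
  (DFunLike.congr_fun H.incl_unit b).symm

/-- An extension of `m*b` to `G × G` restricts to an extension of `m*(b|_H)` to `H × H`. -/
theorem ClosedSubgroupoid.proj_map_mk {G : AffineGroupoid 𝕜 A B} (H : ClosedSubgroupoid G I J)
    {F : B ⊗[𝕜] B} {b : B} (hF : Fib.proj G.src G.tgt F = G.mul b) :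
    Fib.proj H.src H.tgt (TensorProduct.map (Ideal.Quotient.mkₐ 𝕜 J).toLinearMap
      (Ideal.Quotient.mkₐ 𝕜 J).toLinearMap F) = H.mul (Ideal.Quotient.mk J b) := by
  have h := DFunLike.congr_fun H.incl_mul b
  rw [AlgHom.comp_apply, ← hF, Fib.lift_proj] at h
  refine Eq.trans ?_ h
  clear h hF
  induction F with
  | zero => simp
  | tmul x y => simp [Fib.proj_tmul]
  | add x y hx hy => simp only [map_add, hx, hy]

theorem GScheme.restrictTensor_proj {G : AffineGroupoid 𝕜 A B} (M : GScheme G C)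
    (H : ClosedSubgroupoid G I J) (F : B ⊗[𝕜] C) :
    M.restrictTensor H (Fib.proj G.src M.moment F) = Fib.proj H.src (M.preimageMoment I)
      (TensorProduct.map (Ideal.Quotient.mkₐ 𝕜 J).toLinearMap (M.restrict I).toLinearMap F) := by
  rw [GScheme.restrictTensor, Fib.lift_proj]
  induction F with
  | zero => simp
  | tmul x y => simp [Fib.proj_tmul]
  | add x y hx hy => simp only [map_add, hx, hy]

theorem GScheme.restrict_moment {G : AffineGroupoid 𝕜 A B} (M : GScheme G C) (I : Ideal A) (a : A) :
    M.restrict I (M.moment a) = M.preimageMoment I (Ideal.Quotient.mk I a) :=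
  (Fib.inl_apply_eq (f := Ideal.Quotient.mkₐ 𝕜 I) (g := M.moment) a).symm

theorem GScheme.restrict_mem_invariants {G : AffineGroupoid 𝕜 A B} (M : GScheme G C)
    (H : ClosedSubgroupoid G I J) {f : C} : M.restrict I f ∈ M.invariants H ↔
      M.restrictTensor H (M.act f) = Fib.inr H.src (M.preimageMoment I) (M.restrict I f) := by
  rw [GScheme.invariants, AlgHom.mem_equalizer]
  have h : M.restrictAct H (M.restrict I f) = M.restrictTensor H (M.act f) := by
    rw [GScheme.restrictAct, GScheme.restrict, Fib.lift_inr]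
    rfl
  rw [h]

variable {G : AffineSymplecticGroupoid 𝕜 A B} {H : ClosedSubgroupoid G.toAffineGroupoid I J}

/-- For a coisotropic subvariety with ideal `I` and `i ∈ I`, the covector field `di` along `S` lies
in `N*_S X ∩ σ⁻¹(TS)`, so it is a section of the Lie algebroid of the stabilizer subgroupoid. -/
theorem IsStabilizer.exists_isLieSection (hH : IsStabilizer G H)
    (hI : IsCoisotropic G.baseBracket I) {i : A} (hi : i ∈ I) :
    ∃ D : B ⧸ J →ₗ[𝕜] A ⧸ I, H.IsLieSection D ∧
      ∀ b, Ideal.Quotient.mk I (G.lieSection i b) = D (Ideal.Quotient.mk J b) := by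
  have hmem : G.cotangentToLie I (1 ⊗ₜ KaehlerDifferential.D 𝕜 A i) ∈ H.lieAlgebroid := by
    rw [hH.lieAlgebroid_eq]
    refine Submodule.mem_map_of_mem ⟨?_, ?_⟩
    · have h : Ideal.Quotient.mk I i = 0 := Ideal.Quotient.eq_zero_iff_mem.mpr hi
      simp [conormal, LinearMap.mem_ker, h]
    · intro f hf
      have h : G.sharp I (1 ⊗ₜ KaehlerDifferential.D 𝕜 A i) f =
          Ideal.Quotient.mk I (G.baseBracket i f) := by
        simp [AffineSymplecticGroupoid.sharp]
      rw [h]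
      exact Ideal.Quotient.eq_zero_iff_mem.mpr (hI i hi f hf)
  obtain ⟨D, h1, h2, h3⟩ := hmem
  refine ⟨D, ⟨h1, h2⟩, fun b => ?_⟩
  have h := LinearMap.congr_fun h3 b
  refine Eq.trans ?_ h
  simp [AffineSymplecticGroupoid.cotangentToLie, AffineSymplecticGroupoid.lieSection_apply]

/-- Functions on `M` whose restriction to `μ⁻¹(S)` is invariant Poisson commute along `μ⁻¹(S)` with
the components `μ*i` of the moment map, for `i` in the ideal of `S`. -/
theorem IsStabilizer.restrict_bracket_moment (hH : IsStabilizer G H)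
    (hI : IsCoisotropic G.baseBracket I) {M : GScheme G.toAffineGroupoid C}
    {P : PoissonBracket 𝕜 C} (hM : M.IsHamiltonian P) {i : A} (hi : i ∈ I) {f : C}
    (hf : M.restrict I f ∈ M.invariants H) :
    M.restrict I (P.bracket (M.moment i) f) = 0 := by
  obtain ⟨D, hD, hDi⟩ := hH.exists_isLieSection hI hi
  obtain ⟨F, hF⟩ := Fib.proj_surjective G.src M.moment (M.act f)
  rw [M.restrict_mem_invariants, ← hF, M.restrictTensor_proj] at hf
  rw [M.bracket_moment P.isBivector hM i hF, ← hD.productLinear_eq_zero _ hf]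
  clear hf hF
  induction F with
  | zero => simp
  | tmul x y => simp [M.restrict_moment, hDi]
  | add x y hx hy => simp only [map_add, hx, hy]

theorem IsStabilizer.bracket_tgt_mem (hH : IsStabilizer G H)
    (hI : IsCoisotropic G.baseBracket I) {i : A} (hi : i ∈ I) {b : B} (hb : b ∈ J) :
    G.ω.bracket (G.tgt i) b ∈ J := by
  obtain ⟨D, hD, hDi⟩ := hH.exists_isLieSection hI hi
  obtain ⟨F, hF⟩ := Fib.proj_surjective G.src G.tgt (G.mul b)
  have hF' := H.proj_map_mk hF
  rw [Ideal.Quotient.eq_zero_iff_mem.mpr hb, map_zero, ← map_zero (Fib.inr H.src H.tgt)] at hF'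
  have h := G.regular.bracket_moment G.ω.isBivector G.multiplicative i hF
  rw [← Ideal.Quotient.eq_zero_iff_mem, ← hD.productLinear_eq_zero _ hF']
  refine (congrArg _ h).trans ?_
  clear hF hF' h
  induction F with
  | zero => simp
  | tmul x y => simp [AffineGroupoid.regular, ← H.tgt_mk, hDi]
  | add x y hx hy => simp only [map_add, hx, hy]

/-- Since the units are coisotropic, `{s*i, ·}` and `{t*i, ·}` agree at the units on functions
that vanish there. -/
theorem AffineSymplecticGroupoid.unit_bracket_src (G : AffineSymplecticGroupoid 𝕜 A B) (i : A)
    (b : B) : G.unit (G.ω.bracket (G.src i) b) =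
      G.lieSection i b - G.lieSection i (G.tgt (G.unit b)) := by
  have h := G.unit_bracket (f := G.src i - G.tgt i) (g := b - G.tgt (G.unit b))
    (by rw [map_sub, G.unit_src_apply, G.unit_tgt_apply, sub_self])
    (by rw [map_sub, G.unit_tgt_apply, sub_self])
  simp only [map_sub, LinearMap.sub_apply, G.bracket_src_tgt, map_zero] at h
  rw [G.lieSection_apply, G.lieSection_apply]
  linear_combination h

theorem IsStabilizer.bracket_src_mem (hH : IsStabilizer G H)
    (hI : IsCoisotropic G.baseBracket I) {i : A} (hi : i ∈ I) {b : B} (hb : b ∈ J) :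
    G.ω.bracket (G.src i) b ∈ J := by
  obtain ⟨D, hD, hDi⟩ := hH.exists_isLieSection hI hi
  obtain ⟨F, hF⟩ := Fib.proj_surjective G.src G.tgt (G.mul b)
  have hF' := H.proj_map_mk hF
  rw [Ideal.Quotient.eq_zero_iff_mem.mpr hb, map_zero] at hF'
  rw [← Ideal.Quotient.eq_zero_iff_mem, ← hD.productLinear_left_eq_zero hF', G.bracket_src i hF]
  clear hF hF'
  induction F with
  | zero => simp
  | tmul x y =>
    simp [G.unit_bracket_src, ← H.src_mk, hDi, H.unit_mk, H.tgt_mk]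
  | add x y hx hy => simp only [map_add, hx, hy]

end InfinitesimalAction

/-! ### Derivations of smooth algebras -/

section Derivations

variable {𝕜 : Type u₁} [Field 𝕜]
  {A : Type u₂} [CommRing A] [Algebra 𝕜 A]
  {B : Type u₃} [CommRing B] [Algebra 𝕜 B]
  {R : Type u₄} [CommRing R] [Algebra 𝕜 R]

/-- `D : B → R` is a derivation along the homomorphism `χ : B → R`, i.e. a vector field along the
morphism `Spec R → Spec B`. (A homomorphism `χ` is used instead of a `B`-module structure on `R`,
since several homomorphisms `B → R` occur at the same time.) -/
def IsDerivationAlong (χ : B →ₐ[𝕜] R) (D : B →ₗ[𝕜] R) : Prop :=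
  ∀ x y, D (x * y) = χ x * D y + χ y * D x

theorem IsDerivationAlong.sub {χ : B →ₐ[𝕜] R} {D E : B →ₗ[𝕜] R} (hD : IsDerivationAlong χ D)
    (hE : IsDerivationAlong χ E) : IsDerivationAlong χ (D - E) := by
  intro x y
  rw [LinearMap.sub_apply, hD, hE, LinearMap.sub_apply, LinearMap.sub_apply]
  ring

theorem IsDerivationAlong.comp {χ : B →ₐ[𝕜] R} {D : B →ₗ[𝕜] R} (hD : IsDerivationAlong χ D)
    (φ : A →ₐ[𝕜] B) : IsDerivationAlong (χ.comp φ) (D ∘ₗ φ.toLinearMap) := by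
  intro x y
  simp [hD _ _]

theorem IsBivector.isDerivationAlong {P : B →ₗ[𝕜] B →ₗ[𝕜] B} (hP : IsBivector P) (χ : B →ₐ[𝕜] R)
    (f : B) : IsDerivationAlong χ (χ.toLinearMap ∘ₗ P f) := by
  intro x y
  simp only [LinearMap.comp_apply, hP.leibniz, AlgHom.toLinearMap_apply, map_add, map_mul]
  ring

/-- The differential of a smooth algebra in terms of a finite family of functions, whose
differentials span the cotangent bundle, and of vector fields splitting this family. -/
theorem exists_coordinates [Algebra.Smooth 𝕜 B] :
    ∃ (ι : Type u₃) (_ : Fintype ι) (b : ι → B) (V : ι → Derivation 𝕜 B B),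
      ∀ (x : B), KaehlerDifferential.D 𝕜 B x = ∑ k, V k x • KaehlerDifferential.D 𝕜 B (b k) := by
  have hfg : (Submodule.span B (Set.range (KaehlerDifferential.D 𝕜 B))).FG := by
    rw [KaehlerDifferential.span_range_derivation]
    exact Module.Finite.fg_top
  obtain ⟨t, ht, hspan⟩ := (Submodule.fg_span_iff_fg_span_finset_subset _).mp hfg
  rw [KaehlerDifferential.span_range_derivation] at hspan
  choose b hb using fun k : t => ht k.2
  have hsurj : Function.Surjective (Fintype.linearCombination B (fun k : t => (k : Ω[B⁄𝕜]))) := by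
    rw [← LinearMap.range_eq_top, Fintype.range_linearCombination, hspan]
    exact congrArg _ Subtype.range_coe
  obtain ⟨σ, hσ⟩ := Module.projective_lifting_property _ LinearMap.id hsurj
  refine ⟨t, inferInstance, b,
    fun k => (LinearMap.proj k ∘ₗ σ).compDer (KaehlerDifferential.D 𝕜 B), fun x => ?_⟩
  have h := LinearMap.congr_fun hσ (KaehlerDifferential.D 𝕜 B x)
  rw [LinearMap.comp_apply, Fintype.linearCombination_apply, LinearMap.id_apply] at h
  refine h.symm.trans (Finset.sum_congr rfl fun k _ => ?_)
  rw [hb]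
  rfl

theorem IsDerivationAlong.eq_sum {ι : Type*} [Fintype ι] {b : ι → B} {V : ι → Derivation 𝕜 B B}
    (hbV : ∀ (x : B),
      KaehlerDifferential.D 𝕜 B x = ∑ k, V k x • KaehlerDifferential.D 𝕜 B (b k))
    {χ : B →ₐ[𝕜] R} {D : B →ₗ[𝕜] R} (hD : IsDerivationAlong χ D) (x : B) :
    D x = ∑ k, D (b k) * χ (V k x) := by
  let : Algebra B R := χ.toRingHom.toAlgebra
  have : IsScalarTower 𝕜 B R := .of_algebraMap_eq fun r => (χ.commutes r).symm
  let E : Derivation 𝕜 B R := Derivation.mk' D fun x y => hD x y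
  have h := congrArg E.liftKaehlerDifferential (hbV x)
  simp only [Derivation.liftKaehlerDifferential_comp_D, map_sum, map_smul] at h
  refine h.trans (Finset.sum_congr rfl fun k _ => ?_)
  exact mul_comm _ _

/-- On a smooth affine variety every vector field along a closed subvariety extends. -/
theorem IsDerivationAlong.exists_lift [Algebra.Smooth 𝕜 B] {χ : B →ₐ[𝕜] R}
    (hχ : Function.Surjective χ) {D : B →ₗ[𝕜] R} (hD : IsDerivationAlong χ D) :
    ∃ W : Derivation 𝕜 B B, ∀ x, χ (W x) = D x := by
  obtain ⟨ι, _, b, V, hbV⟩ := exists_coordinates (𝕜 := 𝕜) (B := B)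
  choose c hc using fun k => hχ (D (b k))
  refine ⟨∑ k, c k • V k, fun x => ?_⟩
  rw [hD.eq_sum hbV x, ← Derivation.coeFnAddMonoidHom_apply, map_sum, Finset.sum_apply, map_sum]
  refine Finset.sum_congr rfl fun k _ => ?_
  rw [Derivation.coeFnAddMonoidHom_apply, Derivation.smul_apply, smul_eq_mul, map_mul, hc]

/-- On a symplectic variety, vector fields along any morphism are spanned by Hamiltonian ones. -/
theorem SymplecticForm.exists_eq_sum [Algebra.Smooth 𝕜 B] (ω : SymplecticForm 𝕜 B)
    {χ : B →ₐ[𝕜] R} {D : B →ₗ[𝕜] R} (hD : IsDerivationAlong χ D) :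
    ∃ (ι : Type u₃) (_ : Fintype ι) (b : ι → B) (c : ι → R),
      ∀ x, D x = ∑ k, c k * χ (ω.bracket (b k) x) := by
  obtain ⟨ι, _, b, V, hbV⟩ := exists_coordinates (𝕜 := 𝕜) (B := B)
  have hV : ∀ W : Derivation 𝕜 B B, W = ∑ k, W (b k) • V k := by
    intro W
    ext x
    have hW : IsDerivationAlong (AlgHom.id 𝕜 B) (W : B →ₗ[𝕜] B) := fun x y => W.leibniz x y
    rw [← Derivation.coeFnAddMonoidHom_apply (∑ k, W (b k) • V k), map_sum, Finset.sum_apply]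
    exact hW.eq_sum hbV x
  have hX : ∀ j, V j = ∑ k, (-ω.form (V j) (V k)) • ω.hamiltonian (b k) := by
    intro j
    apply ω.nondegenerate.injective
    ext W
    conv_lhs => rw [hV W]
    simp only [map_sum, map_smul, LinearMap.sum_apply, LinearMap.smul_apply, smul_eq_mul,
      ω.form_hamiltonian]
    exact Finset.sum_congr rfl fun k _ => by ring
  refine ⟨ι, inferInstance, b, fun k => ∑ j, D (b j) * χ (-ω.form (V j) (V k)), fun x => ?_⟩
  rw [hD.eq_sum hbV x]
  simp only [Finset.sum_mul]
  rw [Finset.sum_comm]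
  refine Finset.sum_congr rfl fun j _ => ?_
  conv_lhs => rw [hX j]
  rw [← Derivation.coeFnAddMonoidHom_apply, map_sum, Finset.sum_apply, map_sum, Finset.mul_sum]
  refine Finset.sum_congr rfl fun k _ => ?_
  rw [Derivation.coeFnAddMonoidHom_apply, Derivation.smul_apply, smul_eq_mul, map_mul, mul_assoc]
  rfl

/-- If the vector field `V` vanishes along the subscheme with ideal `J`, then so do the functions
`ω(V, W)`. -/
theorem SymplecticForm.form_mem [Algebra.Smooth 𝕜 B] (ω : SymplecticForm 𝕜 B) {J : Ideal B}
    {V : Derivation 𝕜 B B} (hV : ∀ x, V x ∈ J) (W : Derivation 𝕜 B B) : ω.form V W ∈ J := by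
  have hW : IsDerivationAlong (AlgHom.id 𝕜 B) (W : B →ₗ[𝕜] B) := fun x y => W.leibniz x y
  obtain ⟨ι, _, b, c, hbc⟩ := ω.exists_eq_sum hW
  have hW' : W = ∑ k, c k • ω.hamiltonian (b k) := by
    ext x
    rw [← Derivation.coeFnAddMonoidHom_apply (∑ k, _), map_sum, Finset.sum_apply]
    exact hbc x
  rw [hW', map_sum]
  refine Ideal.sum_mem _ fun k _ => ?_
  rw [map_smul, ω.form_antisymm, ω.form_hamiltonian, neg_neg]
  exact J.mul_mem_left _ (hV _)

/-- The point of `Spec B` over the dual numbers given by a vector field along `χ`. -/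
def IsDerivationAlong.toDualNumber {χ : B →ₐ[𝕜] R} {D : B →ₗ[𝕜] R} (hD : IsDerivationAlong χ D) :
    B →ₐ[𝕜] DualNumber R :=
  AlgHom.ofLinearMap
    (TrivSqZeroExt.inlAlgHom 𝕜 R R ∘ₗ χ.toLinearMap +
      (TrivSqZeroExt.inrHom R R).restrictScalars 𝕜 ∘ₗ D)
    (by
      have h1 : D 1 = 0 := by simpa using hD 1 1
      simp [h1])
    (fun x y => by
      ext
      · simp
      · simp [hD x y, mul_comm (D x)])

@[simp]
theorem IsDerivationAlong.fst_toDualNumber {χ : B →ₐ[𝕜] R} {D : B →ₗ[𝕜] R}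
    (hD : IsDerivationAlong χ D) (x : B) : (hD.toDualNumber x).fst = χ x := by
  simp [toDualNumber]

@[simp]
theorem IsDerivationAlong.snd_toDualNumber {χ : B →ₐ[𝕜] R} {D : B →ₗ[𝕜] R}
    (hD : IsDerivationAlong χ D) (x : B) : (hD.toDualNumber x).snd = D x := by
  simp [toDualNumber]

theorem isDerivationAlong_snd (p : B →ₐ[𝕜] DualNumber R) {χ : B →ₐ[𝕜] R}
    (hp : ∀ x, (p x).fst = χ x) :
    IsDerivationAlong χ ((TrivSqZeroExt.sndHom R R).restrictScalars 𝕜 ∘ₗ p.toLinearMap) := by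
  intro x y
  simp [hp, mul_comm (p x).snd]

/-- The infinitesimal lifting property of a smooth ring homomorphism. It is stated for homomorphisms,
as the `R`-algebra structures on `P` and `Q` needed here are not the canonical ones. -/
theorem exists_lift_of_smooth {R S P Q : Type*} [CommRing R] [CommRing S] [CommRing P] [CommRing Q]
    {f : R →+* S} (hf : f.Smooth) (φ : S →+* Q) (π : P →+* Q) (hπ : Function.Surjective π)
    (hker : IsNilpotent (RingHom.ker π)) (g : R →+* P) (h : π.comp g = φ.comp f) :
    ∃ ψ : S →+* P, π.comp ψ = φ ∧ ψ.comp f = g := by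
  let := f.toAlgebra
  let := g.toAlgebra
  let := (φ.comp f).toAlgebra
  have : Algebra.Smooth R S := hf
  let φ' : S →ₐ[R] Q := ⟨φ, fun _ => rfl⟩
  let π' : P →ₐ[R] Q := ⟨π, fun r => RingHom.congr_fun h r⟩
  let ψ := Algebra.FormallySmooth.liftOfSurjective φ' π' hπ hker
  refine ⟨ψ.toRingHom, RingHom.ext fun x => ?_, RingHom.ext fun r => ψ.commutes r⟩
  exact Algebra.FormallySmooth.liftOfSurjective_apply φ' π' hπ hker x

/-- Vector fields lift along a smooth morphism. -/
theorem IsDerivationAlong.exists_extension {s : A →ₐ[𝕜] B} (hs : s.toRingHom.Smooth)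
    {D : A →ₗ[𝕜] B} (hD : IsDerivationAlong s D) :
    ∃ W : B →ₗ[𝕜] B, IsDerivationAlong (AlgHom.id 𝕜 B) W ∧ ∀ a, W (s a) = D a := by
  let π : DualNumber B →ₐ[𝕜] B := TrivSqZeroExt.fstHom 𝕜 B B
  have hker : IsNilpotent (RingHom.ker (π : DualNumber B →+* B)) :=
    ⟨2, TrivSqZeroExt.kerIdeal_sq B B⟩
  obtain ⟨ψ, h1, h2⟩ := exists_lift_of_smooth hs (RingHom.id B) (π : DualNumber B →+* B)
    (fun x => ⟨TrivSqZeroExt.inl x, rfl⟩) hker (hD.toDualNumber : A →+* DualNumber B)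
    (RingHom.ext fun a => hD.fst_toDualNumber a)
  have h2' : ∀ a, ψ (s a) = hD.toDualNumber a := fun a => RingHom.congr_fun h2 a
  let p : B →ₐ[𝕜] DualNumber B := ⟨ψ, fun r => by
    have := h2' (algebraMap 𝕜 A r)
    rwa [s.commutes, AlgHom.commutes] at this⟩
  refine ⟨_, isDerivationAlong_snd p fun x => RingHom.congr_fun h1 x, fun a => ?_⟩
  refine Eq.trans ?_ (hD.snd_toDualNumber a)
  exact congrArg TrivSqZeroExt.snd (h2' a)

end Derivations

/-! ### Translating vector fields to the units -/

section Points

variable {𝕜 : Type u₁} [Field 𝕜]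
  {A : Type u₂} [CommRing A] [Algebra 𝕜 A]
  {B : Type u₃} [CommRing B] [Algebra 𝕜 B]
  {R : Type u₄} [CommRing R] [Algebra 𝕜 R]
  (G : AffineGroupoid 𝕜 A B)

/-- The product of two composable `R`-points of a groupoid. -/
def AffineGroupoid.pointMul (g h : B →ₐ[𝕜] R) (hgh : g.comp G.src = h.comp G.tgt) : B →ₐ[𝕜] R :=
  (Fib.lift G.src G.tgt g h hgh).comp G.mul

theorem AffineGroupoid.pointMul_src (g h : B →ₐ[𝕜] R) (hgh : g.comp G.src = h.comp G.tgt) :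
    (G.pointMul g h hgh).comp G.src = h.comp G.src := by
  rw [pointMul, AlgHom.comp_assoc, G.mul_src, ← AlgHom.comp_assoc, Fib.lift_comp_inr]

theorem AffineGroupoid.pointMul_tgt (g h : B →ₐ[𝕜] R) (hgh : g.comp G.src = h.comp G.tgt) :
    (G.pointMul g h hgh).comp G.tgt = g.comp G.tgt := by
  rw [pointMul, AlgHom.comp_assoc, G.mul_tgt, ← AlgHom.comp_assoc, Fib.lift_comp_inl]

theorem AffineGroupoid.pointMul_congr {g g' h h' : B →ₐ[𝕜] R} (hg : g = g') (hh : h = h')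
    (hgh : g.comp G.src = h.comp G.tgt) (hgh' : g'.comp G.src = h'.comp G.tgt) :
    G.pointMul g h hgh = G.pointMul g' h' hgh' := by
  subst hg hh; rfl

theorem AffineGroupoid.pointMul_assoc (g h k : B →ₐ[𝕜] R) (hgh : g.comp G.src = h.comp G.tgt)
    (hhk : h.comp G.src = k.comp G.tgt) :
    G.pointMul (G.pointMul g h hgh) k ((G.pointMul_src g h hgh).trans hhk) =
      G.pointMul g (G.pointMul h k hhk) (hgh.trans (G.pointMul_tgt h k hhk).symm) := by
  let T : Fib G.src ((Fib.inl G.src G.tgt).comp G.tgt) →ₐ[𝕜] R :=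
    Fib.lift _ _ g (Fib.lift G.src G.tgt h k hhk)
      (by rw [← AlgHom.comp_assoc, Fib.lift_comp_inl, hgh])
  have hinl : T.comp (Fib.inl _ _) = g := Fib.lift_comp_inl _ _ _ _ _
  have hinr : T.comp (Fib.inr _ _) = Fib.lift G.src G.tgt h k hhk := Fib.lift_comp_inr _ _ _ _ _
  have h1 : T.comp (mulTensorId G.src G.tgt G.mul G.mul_src G.tgt) =
      Fib.lift G.src G.tgt (G.pointMul g h hgh) k ((G.pointMul_src g h hgh).trans hhk) := by
    rw [mulTensorId, Fib.comp_lift]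
    refine Fib.lift_congr ?_ ?_ _ _
    · rw [← AlgHom.comp_assoc, Fib.comp_lift, pointMul]
      congr 1
      refine Fib.lift_congr hinl ?_ _ _
      rw [← AlgHom.comp_assoc, hinr, Fib.lift_comp_inl]
    · rw [← AlgHom.comp_assoc, hinr, Fib.lift_comp_inr]
  have h2 : T.comp (idTensorAct G.src G.tgt G.tgt G.mul G.mul_tgt) =
      Fib.lift G.src G.tgt g (G.pointMul h k hhk)
        (hgh.trans (G.pointMul_tgt h k hhk).symm) := by
    rw [idTensorAct, Fib.comp_lift]
    refine Fib.lift_congr hinl ?_ _ _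
    rw [← AlgHom.comp_assoc, hinr, pointMul]
  rw [pointMul, ← h1, AlgHom.comp_assoc, G.mul_assoc, ← AlgHom.comp_assoc, h2]
  rfl

theorem AffineGroupoid.one_pointMul (g : B →ₐ[𝕜] R) (e : A →ₐ[𝕜] R) (he : e = g.comp G.tgt) :
    G.pointMul (e.comp G.unit) g
      (by rw [AlgHom.comp_assoc, G.unit_src, AlgHom.comp_id, he]) = g := by
  subst he
  have h := congrArg g.comp G.one_mul
  rw [← AlgHom.comp_assoc, Fib.comp_lift] at h
  exact h

theorem AffineGroupoid.pointMul_inv (g : B →ₐ[𝕜] R) :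
    G.pointMul g (g.comp G.inv) (by rw [AlgHom.comp_assoc, G.inv_tgt]) =
      (g.comp G.tgt).comp G.unit := by
  have h := congrArg g.comp G.mul_inv
  rw [← AlgHom.comp_assoc, Fib.comp_lift] at h
  exact h

theorem AffineGroupoid.inv_pointMul (g : B →ₐ[𝕜] R) :
    G.pointMul (g.comp G.inv) g (by rw [AlgHom.comp_assoc, G.inv_src]) =
      (g.comp G.src).comp G.unit := by
  have h := congrArg g.comp G.inv_mul
  rw [← AlgHom.comp_assoc, Fib.comp_lift] at h
  exact h

theorem AffineGroupoid.pointMul_inv_pointMul (g h : B →ₐ[𝕜] R)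
    (hgh : (g.comp G.inv).comp G.src = h.comp G.tgt) :
    G.pointMul g (G.pointMul (g.comp G.inv) h hgh)
      (by rw [G.pointMul_tgt, AlgHom.comp_assoc, G.inv_tgt]) = h := by
  rw [← G.pointMul_assoc g (g.comp G.inv) h (by rw [AlgHom.comp_assoc, G.inv_tgt]) hgh]
  refine (G.pointMul_congr (G.pointMul_inv g) rfl _ ?_).trans (G.one_pointMul h _ ?_)
  · rw [AlgHom.comp_assoc, G.unit_src, AlgHom.comp_id, ← hgh, AlgHom.comp_assoc, G.inv_src]
  · rw [← hgh, AlgHom.comp_assoc, G.inv_src]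

/-- A vector field `u` along `q : Spec R → G` that is tangent to the fibres of the target map is a
left translate `u = q · u'` of a vector field `u'` along the units. In terms of points over the dual
numbers, `u' = q⁻¹ (q + εu)`. -/
theorem AffineGroupoid.exists_left_translate {q : B →ₐ[𝕜] R} {u : B →ₗ[𝕜] R}
    (hu : IsDerivationAlong q u) (hut : ∀ a, u (G.tgt a) = 0) :
    ∃ u' : B →ₗ[𝕜] R, IsDerivationAlong ((q.comp G.src).comp G.unit) u' ∧
      (∀ a, u' (G.tgt a) = 0) ∧ ∀ (b : B) (F : B ⊗[𝕜] B),
        Fib.proj G.src G.tgt F = G.mul b → u b = productLinear q.toLinearMap u' F := by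
  let g : B →ₐ[𝕜] DualNumber R := (TrivSqZeroExt.inlAlgHom 𝕜 R R).comp q
  let g' : B →ₐ[𝕜] DualNumber R := hu.toDualNumber
  have hgg' : g.comp G.tgt = g'.comp G.tgt := by
    ext a
    · simp [g, g']
    · simp [g, g', hut]
  have hinv : (g.comp G.inv).comp G.src = g'.comp G.tgt := by
    rw [AlgHom.comp_assoc, G.inv_src, hgg']
  let p := G.pointMul (g.comp G.inv) g' hinv
  have hp : (TrivSqZeroExt.fstHom 𝕜 R R).comp p = (q.comp G.src).comp G.unit := by
    rw [← G.inv_pointMul q]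
    change (TrivSqZeroExt.fstHom 𝕜 R R).comp ((Fib.lift _ _ _ _ _).comp _) = _
    rw [← AlgHom.comp_assoc, Fib.comp_lift, pointMul]
    congr 1
    refine Fib.lift_congr ?_ ?_ _ _
    · ext x; simp [g]
    · ext x; simp [g']
  have hpt : p.comp G.tgt = g.comp G.src := by
    rw [G.pointMul_tgt, AlgHom.comp_assoc, G.inv_tgt]
  refine ⟨_, isDerivationAlong_snd p fun x => DFunLike.congr_fun hp x, fun a => ?_,
    fun b F hF => ?_⟩
  · change (p.comp G.tgt a).snd = 0
    rw [hpt]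
    simp [g]
  · have h := congrArg TrivSqZeroExt.snd
      (DFunLike.congr_fun (G.pointMul_inv_pointMul g g' hinv) b)
    rw [hu.snd_toDualNumber, pointMul, AlgHom.comp_apply, ← hF, Fib.lift_proj] at h
    rw [← h]
    clear h hF
    induction F with
    | zero => simp
    | tmul x y => simp [g, p]
    | add x y hx hy => simp only [map_add, TrivSqZeroExt.snd_add, hx, hy]

end Points

/-! ### Stabilizer subgroupoids are Lagrangian -/

section Lagrangian

variable {𝕜 : Type u₁} [Field 𝕜]
  {A : Type u₂} [CommRing A] [Algebra 𝕜 A]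
  {B : Type u₃} [CommRing B] [Algebra 𝕜 B]
  {R : Type u₄} [CommRing R] [Algebra 𝕜 R]

/-- Along the units, the Hamiltonian vector fields of the functions `s*a` span the kernel of `dt`:
modulo `s*X`, every function vanishes on the units, and the Hamiltonian vector fields of such
functions are tangent to the units. -/
theorem AffineSymplecticGroupoid.exists_eq_sum_bracket_src_unit (G : AffineSymplecticGroupoid 𝕜 A B)
    {e : A →ₐ[𝕜] R} {u : B →ₗ[𝕜] R} (hu : IsDerivationAlong (e.comp G.unit) u)
    (hut : ∀ a, u (G.tgt a) = 0) :
    ∃ (ι : Type u₃) (_ : Fintype ι) (a : ι → A) (c : ι → R),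
      ∀ x, u x = ∑ k, c k * e (G.unit (G.ω.bracket (G.src (a k)) x)) := by
  have := G.isLie.smooth_arrows
  obtain ⟨ι, _, b, c, hbc⟩ := G.ω.exists_eq_sum hu
  refine ⟨ι, inferInstance, fun k => G.unit (b k), c, fun x => ?_⟩
  have hx : u x = u (x - G.tgt (G.unit x)) := by rw [map_sub, hut, sub_zero]
  rw [hx, hbc]
  refine Finset.sum_congr rfl fun k _ => ?_
  have h := G.unit_bracket (f := b k - G.src (G.unit (b k))) (g := x - G.tgt (G.unit x))
    (by rw [map_sub, G.unit_src_apply, sub_self]) (by rw [map_sub, G.unit_tgt_apply, sub_self])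
  rw [map_sub G.ω.bracket, LinearMap.sub_apply, map_sub, sub_eq_zero] at h
  rw [AlgHom.comp_apply, h, map_sub, G.bracket_src_tgt, sub_zero]

/-- The Hamiltonian vector fields of the functions `s*a` span the kernel of `dt`. -/
theorem AffineSymplecticGroupoid.exists_eq_sum_bracket_src (G : AffineSymplecticGroupoid 𝕜 A B)
    {q : B →ₐ[𝕜] R} {u : B →ₗ[𝕜] R} (hu : IsDerivationAlong q u)
    (hut : ∀ a, u (G.tgt a) = 0) :
    ∃ (ι : Type u₃) (_ : Fintype ι) (a : ι → A) (c : ι → R),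
      ∀ x, u x = ∑ k, c k * q (G.ω.bracket (G.src (a k)) x) := by
  obtain ⟨u', hu', hut', htrans⟩ := G.exists_left_translate hu hut
  obtain ⟨ι, _, a, c, hac⟩ := G.exists_eq_sum_bracket_src_unit hu' hut'
  refine ⟨ι, inferInstance, a, c, fun x => ?_⟩
  obtain ⟨F, hF⟩ := Fib.proj_surjective G.src G.tgt (G.mul x)
  rw [htrans x F hF]
  simp only [G.bracket_src _ hF]
  clear hF
  induction F with
  | zero => simp
  | tmul x y =>
    simp only [productLinear_tmul, hac, Finset.mul_sum, AlgHom.toLinearMap_apply,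
      LinearMap.comp_apply, LinearMap.id_apply, map_mul, AlgHom.comp_apply]
    exact Finset.sum_congr rfl fun k _ => by ring
  | add x y hx hy => simp only [map_add, hx, hy, mul_add, Finset.sum_add_distrib]

theorem IsDerivationAlong.exists_descend {I : Ideal A} {χ : A ⧸ I →ₐ[𝕜] R} {D : A →ₗ[𝕜] R}
    (hD : IsDerivationAlong (χ.comp (Ideal.Quotient.mkₐ 𝕜 I)) D) (hDI : ∀ i ∈ I, D i = 0) :
    ∃ E : A ⧸ I →ₗ[𝕜] R, IsDerivationAlong χ E ∧ ∀ a, E (Ideal.Quotient.mk I a) = D a := by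
  let E : A ⧸ I →ₗ[𝕜] R := (I.restrictScalars 𝕜).liftQ D hDI ∘ₗ
    (Submodule.Quotient.restrictScalarsEquiv 𝕜 I).symm.toLinearMap
  have hE : ∀ a, E (Ideal.Quotient.mk I a) = D a := fun a => rfl
  refine ⟨E, fun x y => ?_, hE⟩
  obtain ⟨x, rfl⟩ := Ideal.Quotient.mk_surjective x
  obtain ⟨y, rfl⟩ := Ideal.Quotient.mk_surjective y
  rw [← map_mul, hE, hE, hE, hD]
  rfl

variable {I : Ideal A} {J : Ideal B} {G : AffineSymplecticGroupoid 𝕜 A B}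
  {H : ClosedSubgroupoid G.toAffineGroupoid I J}

/-- Let `v` be a vector field on `G` along the closed subscheme `H` whose projection to `X` is tangent
to `S`. If `H → S` is smooth, then some vector field that is tangent to `H` has the same projection.
This is applied with the source and the target map in the place of `s`. -/
theorem exists_tangent_extension [Algebra.Smooth 𝕜 B] {s : A →ₐ[𝕜] B} {s' : A ⧸ I →ₐ[𝕜] B ⧸ J}
    (hs : (Ideal.Quotient.mkₐ 𝕜 J).comp s = s'.comp (Ideal.Quotient.mkₐ 𝕜 I))
    (hsm : s'.toRingHom.Smooth) {v : B →ₗ[𝕜] B ⧸ J}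
    (hv : IsDerivationAlong (Ideal.Quotient.mkₐ 𝕜 J) v) (hvI : ∀ i ∈ I, v (s i) = 0) :
    ∃ W : Derivation 𝕜 B B, (∀ b ∈ J, W b ∈ J) ∧ ∀ a, Ideal.Quotient.mk J (W (s a)) = v (s a) := by
  have hvs := hv.comp s
  rw [hs] at hvs
  obtain ⟨E, hE, hEv⟩ := hvs.exists_descend hvI
  obtain ⟨w, hw, hwE⟩ := hE.exists_extension hsm
  obtain ⟨W, hW⟩ := (hw.comp (Ideal.Quotient.mkₐ 𝕜 J)).exists_lift Ideal.Quotient.mk_surjective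
  refine ⟨W, fun b hb => ?_, fun a => ?_⟩
  · rw [← Ideal.Quotient.eq_zero_iff_mem] at hb ⊢
    refine (hW b).trans ?_
    simp [hb]
  · refine (hW (s a)).trans ((congrArg w (DFunLike.congr_fun hs a)).trans ?_)
    exact (hwE _).trans (hEv a)

/-- A stabilizer subgroupoid is coisotropic, hence Lagrangian. -/
theorem IsStabilizer.isCoisotropic (hH : IsStabilizer G H)
    (hI : IsCoisotropic G.baseBracket I) : IsCoisotropic G.ω.bracket J := by
  intro f hf b hb
  have := G.isLie.smooth_arrows
  have hω := G.ω.isBivector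
  let q := Ideal.Quotient.mkₐ 𝕜 J
  have hq : ∀ x, q x = 0 ↔ x ∈ J := fun x => Ideal.Quotient.eq_zero_iff_mem
  -- Modulo a vector field `W` tangent to `H`, the Hamiltonian vector field of `f` is in `ker dt`.
  obtain ⟨W, hWJ, hW⟩ := exists_tangent_extension H.incl_tgt hH.isLie.smooth_tgt
    (hω.isDerivationAlong q f) (fun i hi => by
      rw [LinearMap.comp_apply, hω.antisymm, map_neg, neg_eq_zero]
      exact (hq _).mpr (hH.bracket_tgt_mem hI hi hf))
  have hWder : IsDerivationAlong q (q.toLinearMap ∘ₗ (W : B →ₗ[𝕜] B)) := by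
    intro x y
    simp
  have hu := (hω.isDerivationAlong q f).sub hWder
  obtain ⟨ι, _, a, c, hac⟩ := G.exists_eq_sum_bracket_src hu (fun a => by
    rw [LinearMap.sub_apply, sub_eq_zero]
    exact (hW a).symm)
  choose c' hc' using fun k => Ideal.Quotient.mk_surjective (c k)
  -- It is then `∑ c k • X_{s*a k}`, and it is `ω`-orthogonal to vector fields tangent to `H`.
  have horth : ∀ W' : Derivation 𝕜 B B, (∀ x ∈ J, W' x ∈ J) →
      ∑ k, c k * q (W' (G.src (a k))) = 0 := by
    intro W' hW'
    let Z : Derivation 𝕜 B B :=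
      G.ω.hamiltonian f - W - ∑ k, c' k • G.ω.hamiltonian (G.src (a k))
    have hZ : ∀ x, Z x ∈ J := by
      intro x
      have h1 : (∑ k, c' k • G.ω.hamiltonian (G.src (a k))) x =
          ∑ k, c' k * G.ω.bracket (G.src (a k)) x := by
        rw [← Derivation.coeFnAddMonoidHom_apply, map_sum, Finset.sum_apply]
        rfl
      rw [← hq, Derivation.sub_apply, h1, map_sub, map_sum, sub_eq_zero]
      refine (hac x).trans (Finset.sum_congr rfl fun k _ => ?_)
      rw [map_mul, ← hc' k]
      rfl
    have h := G.ω.form_mem hZ W'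
    simp only [Z, map_sub, map_sum, map_smul, LinearMap.sub_apply, LinearMap.sum_apply,
      LinearMap.smul_apply, G.ω.form_hamiltonian] at h
    have h2 := (J.sub_mem_iff_right (J.sub_mem (J.neg_mem (hW' f hf))
      (hH.isotropic W W' hWJ hW'))).mp h
    rw [← hq, map_sum] at h2
    rw [← neg_eq_zero, ← Finset.sum_neg_distrib, ← h2]
    refine Finset.sum_congr rfl fun k _ => ?_
    rw [smul_eq_mul, map_mul, map_neg, mul_neg, ← hc' k]
    rfl
  -- The Hamiltonian vector field of `b` has the same image in `TX` as one that is tangent to `H`.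
  obtain ⟨W', hWJ', hW'⟩ := exists_tangent_extension H.incl_src hH.isLie.smooth_src
    (hω.isDerivationAlong q b) (fun i hi => by
      rw [LinearMap.comp_apply, hω.antisymm, map_neg, neg_eq_zero]
      exact (hq _).mpr (hH.bracket_src_mem hI hi hb))
  have h0 : ∑ k, c k * q (G.ω.bracket (G.src (a k)) b) = 0 := by
    rw [← neg_eq_zero, ← Finset.sum_neg_distrib, ← horth W' hWJ']
    refine Finset.sum_congr rfl fun k _ => ?_
    rw [hω.antisymm, map_neg, mul_neg, neg_neg]
    exact congrArg _ (hW' (a k)).symm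
  rw [← hac b, LinearMap.sub_apply, sub_eq_zero] at h0
  rw [← hq]
  exact h0.trans ((hq _).mpr (hWJ b hb))

end Lagrangian

/-! ### Invariance and the reduced bracket -/

section Reduction

variable {𝕜 : Type u₁} [Field 𝕜]
  {A : Type u₂} [CommRing A] [Algebra 𝕜 A]
  {B : Type u₃} [CommRing B] [Algebra 𝕜 B]
  {C : Type u₄} [CommRing C] [Algebra 𝕜 C]
  {I : Ideal A} {J : Ideal B}

/-- The ideal of `H × M` in `G × M`. -/
abbrev prodIdeal (𝕜 : Type u₁) [Field 𝕜] {B : Type u₃} [CommRing B] [Algebra 𝕜 B] (J : Ideal B)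
    (C : Type u₄) [CommRing C] [Algebra 𝕜 C] : Ideal (B ⊗[𝕜] C) :=
  J.map (Algebra.TensorProduct.includeLeft : B →ₐ[𝕜] B ⊗[𝕜] C)

theorem tmul_mem_prodIdeal {b : B} (hb : b ∈ J) (c : C) : b ⊗ₜ[𝕜] c ∈ prodIdeal 𝕜 J C := by
  have h := Ideal.mul_mem_right ((1 : B) ⊗ₜ[𝕜] c) _
    (Ideal.mem_map_of_mem (Algebra.TensorProduct.includeLeft : B →ₐ[𝕜] B ⊗[𝕜] C) hb)
  simpa using h

theorem prodIdeal_induction {p : B ⊗[𝕜] C → Prop} (zero : p 0)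
    (tmul : ∀ b ∈ J, ∀ c, p (b ⊗ₜ c)) (add : ∀ x y, p x → p y → p (x + y)) {x : B ⊗[𝕜] C}
    (hx : x ∈ prodIdeal 𝕜 J C) : p x := by
  have key : ∀ r : B ⊗[𝕜] C, p (r * x) := by
    induction hx using Submodule.span_induction with
    | mem x hx =>
      obtain ⟨b, hb, rfl⟩ := hx
      intro r
      induction r with
      | zero => simpa using zero
      | tmul b' c => simpa using tmul _ (J.mul_mem_left b' hb) c
      | add x y hx hy => rw [add_mul]; exact add _ _ hx hy
    | zero => intro r; rw [mul_zero]; exact zero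
    | add x y _ _ hx hy => intro r; rw [mul_add]; exact add _ _ (hx r) (hy r)
    | smul c x _ hx => intro r; rw [smul_eq_mul, ← mul_assoc]; exact hx (r * c)
  simpa using key 1

theorem prodBracket_mem_prodIdeal {P : B →ₗ[𝕜] B →ₗ[𝕜] B} (Q : C →ₗ[𝕜] C →ₗ[𝕜] C)
    (hJ : IsCoisotropic P J) : IsCoisotropic (prodBracket P Q) (prodIdeal 𝕜 J C) := by
  intro x hx y hy
  refine prodIdeal_induction (p := fun x => prodBracket P Q x y ∈ prodIdeal 𝕜 J C) (by simp)
    (fun b hb c => ?_) (fun x x' hx hx' => by simpa using Ideal.add_mem _ hx hx') hx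
  refine prodIdeal_induction (p := fun y => prodBracket P Q (b ⊗ₜ c) y ∈ prodIdeal 𝕜 J C)
    (by simp) (fun b' hb' c' => ?_) (fun y y' hy hy' => by simpa using Ideal.add_mem _ hy hy') hy
  rw [prodBracket_tmul]
  exact Ideal.add_mem _ (tmul_mem_prodIdeal (hJ b hb b' hb') _)
    (tmul_mem_prodIdeal (J.mul_mem_left b hb') _)

theorem prodBracket_one_tmul_mem {P : B →ₗ[𝕜] B →ₗ[𝕜] B} (Q : C →ₗ[𝕜] C →ₗ[𝕜] C)
    (hP : IsBivector P) (c : C) {x : B ⊗[𝕜] C} (hx : x ∈ prodIdeal 𝕜 J C) :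
    prodBracket P Q (1 ⊗ₜ c) x ∈ prodIdeal 𝕜 J C := by
  refine prodIdeal_induction (p := fun x => prodBracket P Q (1 ⊗ₜ c) x ∈ prodIdeal 𝕜 J C)
    (by simp) (fun b hb c => ?_) (fun x x' hx hx' => by simpa using Ideal.add_mem _ hx hx') hx
  rw [prodBracket_tmul, hP.one_apply, TensorProduct.zero_tmul, zero_add, one_mul]
  exact tmul_mem_prodIdeal hb _

theorem prodBracket_tmul_one_mem {P : B →ₗ[𝕜] B →ₗ[𝕜] B} (Q : C →ₗ[𝕜] C →ₗ[𝕜] C)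
    (hP : IsBivector P) (c : C) {x : B ⊗[𝕜] C} (hx : x ∈ prodIdeal 𝕜 J C) :
    prodBracket P Q x (1 ⊗ₜ c) ∈ prodIdeal 𝕜 J C := by
  refine prodIdeal_induction (p := fun x => prodBracket P Q x (1 ⊗ₜ c) ∈ prodIdeal 𝕜 J C)
    (by simp) (fun b hb c => ?_) (fun x x' hx hx' => by simpa using Ideal.add_mem _ hx hx') hx
  rw [prodBracket_tmul, hP.apply_one, TensorProduct.zero_tmul, zero_add, mul_one]
  exact tmul_mem_prodIdeal hb _

/-- The intersection of `H × M` with `G ×_X M` is `H ×_S μ⁻¹(S)`: since `s(H) ⊆ S`, the condition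
`μ(x) ∈ S` is automatic. -/
theorem GScheme.exists_mem_prodIdeal {G : AffineGroupoid 𝕜 A B} (M : GScheme G C)
    (H : ClosedSubgroupoid G I J) {x : B ⊗[𝕜] C}
    (hx : M.restrictTensor H (Fib.proj G.src M.moment x) = 0) :
    ∃ α ∈ prodIdeal 𝕜 J C, Fib.proj G.src M.moment x = Fib.proj G.src M.moment α := by
  let K : Ideal (B ⊗[𝕜] C) := prodIdeal 𝕜 J C ⊔ fibIdeal G.src M.moment
  let π : B ⊗[𝕜] C →ₐ[𝕜] (B ⊗[𝕜] C) ⧸ K := Ideal.Quotient.mkₐ 𝕜 K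
  have hπ : ∀ y, π y = 0 ↔ y ∈ K := fun y => Ideal.Quotient.eq_zero_iff_mem
  let u : B ⧸ J →ₐ[𝕜] (B ⊗[𝕜] C) ⧸ K :=
    Ideal.Quotient.liftₐ J (π.comp Algebra.TensorProduct.includeLeft) (fun b hb =>
      (hπ _).mpr (Ideal.mem_sup_left (Ideal.mem_map_of_mem _ hb)))
  have hu : ∀ b, u (Ideal.Quotient.mk J b) = π (b ⊗ₜ 1) := fun b => rfl
  have hcond : ∀ a, π (G.src a ⊗ₜ 1) = π (1 ⊗ₜ M.moment a) := by
    intro a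
    rw [← sub_eq_zero, ← map_sub, hπ]
    exact Ideal.mem_sup_right (Ideal.subset_span ⟨a, rfl⟩)
  let v : M.Preimage I →ₐ[𝕜] (B ⊗[𝕜] C) ⧸ K :=
    Fib.lift _ _ (u.comp H.src) (π.comp Algebra.TensorProduct.includeRight) (by
      ext a
      change u (H.src (Ideal.Quotient.mk I a)) = _
      rw [H.src_mk, hu, hcond]
      rfl)
  let φ : Fib H.src (M.preimageMoment I) →ₐ[𝕜] (B ⊗[𝕜] C) ⧸ K :=
    Fib.lift _ _ u v (Fib.lift_comp_inl _ _ _ _ _).symm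
  have hφ : ∀ y, φ (M.restrictTensor H (Fib.proj G.src M.moment y)) = π y := by
    intro y
    rw [M.restrictTensor_proj]
    induction y with
    | zero => simp
    | add x y hx hy => simp only [map_add, hx, hy]
    | tmul b c =>
      have hv : v (M.restrict I c) = π (1 ⊗ₜ c) := Fib.lift_inr _ _ _ c
      change φ (Fib.proj _ _ (Ideal.Quotient.mk J b ⊗ₜ M.restrict I c)) = _
      have hl : φ (Fib.inl _ _ (Ideal.Quotient.mk J b)) = π (b ⊗ₜ 1) := Fib.lift_inl _ _ _ _
      have hr : φ (Fib.inr _ _ (M.restrict I c)) = π (1 ⊗ₜ c) :=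
        (Fib.lift_inr _ _ _ _).trans hv
      rw [Fib.proj_tmul, map_mul, hl, hr, ← map_mul]
      simp
  have hK : x ∈ K := by rw [← hπ, ← hφ, hx, map_zero]
  obtain ⟨α, hα, β, hβ, rfl⟩ := Submodule.mem_sup.mp hK
  exact ⟨α, hα, by rw [map_add, Fib.proj_eq_zero_iff.mpr hβ, add_zero]⟩

theorem GScheme.restrictTensor_eq_zero {G : AffineGroupoid 𝕜 A B} (M : GScheme G C)
    (H : ClosedSubgroupoid G I J) {x : B ⊗[𝕜] C} (hx : x ∈ prodIdeal 𝕜 J C) :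
    M.restrictTensor H (Fib.proj G.src M.moment x) = 0 := by
  refine prodIdeal_induction
    (p := fun x => M.restrictTensor H (Fib.proj G.src M.moment x) = 0) (by simp)
    (fun b hb c => ?_) (fun x y hx hy => by rw [map_add, map_add, hx, hy, add_zero]) hx
  rw [M.restrictTensor_proj]
  simp [Ideal.Quotient.eq_zero_iff_mem.mpr hb]

/-- For `f` with invariant restriction to `μ⁻¹(S)`, the function `𝒜*f` on `G ×_X M` extends to
`G × M` in such a way that it agrees with `1 ⊗ f` on all of `H × M`. -/
theorem GScheme.exists_extension_of_mem_invariants {G : AffineGroupoid 𝕜 A B} (M : GScheme G C)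
    (H : ClosedSubgroupoid G I J) {f : C} (hf : M.restrict I f ∈ M.invariants H) :
    ∃ α ∈ prodIdeal 𝕜 J C, Fib.proj G.src M.moment (1 ⊗ₜ f + α) = M.act f := by
  obtain ⟨F, hF⟩ := Fib.proj_surjective G.src M.moment (M.act f)
  rw [M.restrict_mem_invariants] at hf
  obtain ⟨α, hα, h⟩ := M.exists_mem_prodIdeal H (x := F - 1 ⊗ₜ f) (by
    rw [map_sub, map_sub, hF, hf, M.restrictTensor_proj]
    simp [← Fib.proj_one_tmul])
  refine ⟨α, hα, ?_⟩
  rw [map_add, ← h, map_sub, hF, add_sub_cancel]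

variable {G : AffineSymplecticGroupoid 𝕜 A B} {H : ClosedSubgroupoid G.toAffineGroupoid I J}
  {M : GScheme G.toAffineGroupoid C} {P : PoissonBracket 𝕜 C}

/-- The bracket of functions with invariant restriction to `μ⁻¹(S)` has invariant restriction,
because `H × M` is coisotropic. -/
theorem IsStabilizer.restrict_bracket_mem (hH : IsStabilizer G H)
    (hI : IsCoisotropic G.baseBracket I) (hM : M.IsHamiltonian P) {f g : C}
    (hf : M.restrict I f ∈ M.invariants H) (hg : M.restrict I g ∈ M.invariants H) :
    M.restrict I (P.bracket f g) ∈ M.invariants H := by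
  obtain ⟨α, hα, hfα⟩ := M.exists_extension_of_mem_invariants H hf
  obtain ⟨β, hβ, hgβ⟩ := M.exists_extension_of_mem_invariants H hg
  have hω := G.ω.isBivector
  have h := proj_prodBracket hω P.isBivector P.isBivector hM hfα hgβ
  have hmem : prodBracket G.ω.bracket P.bracket (1 ⊗ₜ f + α) (1 ⊗ₜ g + β)
      - (1 : B) ⊗ₜ[𝕜] P.bracket f g ∈ prodIdeal 𝕜 J C := by
    have h1 : prodBracket G.ω.bracket P.bracket (1 ⊗ₜ f) (1 ⊗ₜ g) =
        (1 : B) ⊗ₜ[𝕜] P.bracket f g := by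
      rw [prodBracket_tmul, hω.one_apply]
      simp
    have h2 := prodBracket_one_tmul_mem P.bracket hω f hβ
    have h3 := prodBracket_tmul_one_mem P.bracket hω g hα
    have h4 := prodBracket_mem_prodIdeal P.bracket (hH.isCoisotropic hI) α hα β hβ
    have h5 := Ideal.add_mem _ (Ideal.add_mem _ h2 h3) h4
    convert h5 using 1
    rw [map_add, map_add, LinearMap.add_apply, LinearMap.add_apply, h1]
    abel
  have h2 := M.restrictTensor_eq_zero H hmem
  rw [map_sub, map_sub, h, sub_eq_zero, M.restrictTensor_proj] at h2
  rw [M.restrict_mem_invariants, h2]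
  simp [← Fib.proj_one_tmul]

/-- Functions whose restriction to `μ⁻¹(S)` is invariant normalize the ideal of `μ⁻¹(S)`. -/
theorem IsStabilizer.restrict_bracket_eq_zero (hH : IsStabilizer G H)
    (hI : IsCoisotropic G.baseBracket I) (hM : M.IsHamiltonian P) {f g : C}
    (hf : M.restrict I f ∈ M.invariants H) (hg : M.restrict I g = 0) :
    M.restrict I (P.bracket f g) = 0 := by
  have hg' : g ∈ I.map M.moment := mem_map_of_inr_eq_zero I M.moment hg
  clear hg
  have hmom : ∀ i ∈ I, M.restrict I (M.moment i) = 0 := fun i hi => by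
    rw [M.restrict_moment, Ideal.Quotient.eq_zero_iff_mem.mpr hi, map_zero]
  induction hg' using Submodule.span_induction with
  | mem x hx =>
    obtain ⟨i, hi, rfl⟩ := hx
    rw [P.isBivector.antisymm, map_neg, neg_eq_zero]
    exact hH.restrict_bracket_moment hI hM hi hf
  | zero => simp
  | add x y _ _ hx hy => rw [map_add, map_add, hx, hy, add_zero]
  | smul r x hx h =>
    have hx' : M.restrict I x = 0 := by
      have hle : I.map M.moment ≤ RingHom.ker (M.restrict I) := Ideal.map_le_iff_le_comap.mpr hmom
      exact hle hx
    rw [smul_eq_mul, P.leibniz, map_add, map_mul, map_mul, hx', h, mul_zero, mul_zero, add_zero]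

theorem IsStabilizer.restrict_bracket_congr (hH : IsStabilizer G H)
    (hI : IsCoisotropic G.baseBracket I) (hM : M.IsHamiltonian P) {f f' g g' : C}
    (hf : M.restrict I f ∈ M.invariants H) (hg : M.restrict I g ∈ M.invariants H)
    (hff' : M.restrict I f = M.restrict I f') (hgg' : M.restrict I g = M.restrict I g') :
    M.restrict I (P.bracket f g) = M.restrict I (P.bracket f' g') := by
  have h1 := hH.restrict_bracket_eq_zero hI hM (f := g) (g := f - f') hg
    (by rw [map_sub, hff', sub_self])
  have h2 := hH.restrict_bracket_eq_zero hI hM (f := f') (g := g - g') (hff' ▸ hf)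
    (by rw [map_sub, hgg', sub_self])
  rw [P.isBivector.antisymm, map_neg, neg_eq_zero] at h1
  rw [map_sub, map_sub, sub_eq_zero] at h2
  rw [map_sub, LinearMap.sub_apply, map_sub, sub_eq_zero] at h1
  rw [h1, h2]

/-- The bracket on `𝕜[μ⁻¹(S)]^H`, computed by extending functions to `M`. -/
theorem IsStabilizer.exists_poissonBracket (hH : IsStabilizer G H)
    (hI : IsCoisotropic G.baseBracket I) (hM : M.IsHamiltonian P) :
    ∃ Q : PoissonBracket 𝕜 (M.invariants H),
      ∀ (f₁ f₂ : C) (h₁ : M.restrict I f₁ ∈ M.invariants H)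
        (h₂ : M.restrict I f₂ ∈ M.invariants H),
        (Q.bracket ⟨M.restrict I f₁, h₁⟩ ⟨M.restrict I f₂, h₂⟩ : M.Preimage I) =
          M.restrict I (P.bracket f₁ f₂) := by
  choose e he using fun x : M.invariants H => Fib.inr_mk_surjective I M.moment (x : M.Preimage I)
  change ∀ x, M.restrict I (e x) = x at he
  have hmem : ∀ x, M.restrict I (e x) ∈ M.invariants H := fun x => by rw [he]; exact x.2
  let β : M.invariants H → M.invariants H → M.invariants H := fun x y =>
    ⟨M.restrict I (P.bracket (e x) (e y)), hH.restrict_bracket_mem hI hM (hmem x) (hmem y)⟩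
  have hβ : ∀ (x y : M.invariants H) (f g : C), M.restrict I f = x → M.restrict I g = y →
      (β x y : M.Preimage I) = M.restrict I (P.bracket f g) := fun x y f g hf hg =>
    hH.restrict_bracket_congr hI hM (hmem x) (hmem y) ((he x).trans hf.symm)
      ((he y).trans hg.symm)
  let L : M.invariants H →ₗ[𝕜] M.invariants H →ₗ[𝕜] M.invariants H := LinearMap.mk₂ 𝕜 β
    (fun x x' y => Subtype.ext <| by
      rw [hβ (x + x') y (e x + e x') (e y) (by simp [he]) (he y)]
      simp [β])
    (fun c x y => Subtype.ext <| by
      rw [hβ (c • x) y (c • e x) (e y) (by simp [he]) (he y)]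
      simp [β])
    (fun x y y' => Subtype.ext <| by
      rw [hβ x (y + y') (e x) (e y + e y') (he x) (by simp [he])]
      simp [β])
    (fun c x y => Subtype.ext <| by
      rw [hβ x (c • y) (e x) (c • e y) (he x) (by simp [he])]
      simp [β])
  have hL : ∀ x y, (L x y : M.Preimage I) = M.restrict I (P.bracket (e x) (e y)) :=
    fun _ _ => rfl
  have hL₂ : ∀ x y z, (L x (L y z) : M.Preimage I) =
      M.restrict I (P.bracket (e x) (P.bracket (e y) (e z))) :=
    fun x y z => hβ x (L y z) _ _ (he x) rfl
  refine ⟨⟨L, fun x => Subtype.ext ?_, fun x y z => Subtype.ext ?_, fun x y z => Subtype.ext ?_⟩,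
    fun f₁ f₂ h₁ h₂ => hβ _ _ _ _ rfl rfl⟩
  · rw [hL, P.bracket_self, map_zero]
    rfl
  · refine (hβ x (y * z) (e x) (e y * e z) (he x) (by simp [he])).trans ?_
    rw [P.leibniz]
    simp [hL, he]
  · simp only [Subalgebra.coe_add, hL₂, ← map_add, P.jacobi]
    simp

end Reduction

end CoisotropicReduction

end

open CoisotropicReduction in
theorem theorem1 {𝕜 : Type*} [RCLike 𝕜]
    {A : Type*} [CommRing A] [Algebra 𝕜 A]
    {B : Type*} [CommRing B] [Algebra 𝕜 B]
    {C : Type*} [CommRing C] [Algebra 𝕜 C]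
    (G : AffineSymplecticGroupoid 𝕜 A B)
    (I : Ideal A) (hI_smooth : Algebra.Smooth 𝕜 (A ⧸ I))
    (hI_coisotropic : IsCoisotropic G.baseBracket I)
    (J : Ideal B) (H : ClosedSubgroupoid G.toAffineGroupoid I J) (hH : IsStabilizer G H)
    (P : PoissonBracket 𝕜 C) (M : GScheme G.toAffineGroupoid C) (hM : M.IsHamiltonian P) :
    ∃! Q : PoissonBracket 𝕜 (M.invariants H),
      ∀ (f₁ f₂ : C) (h₁ : M.restrict I f₁ ∈ M.invariants H)
        (h₂ : M.restrict I f₂ ∈ M.invariants H),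
        (Q.bracket ⟨M.restrict I f₁, h₁⟩ ⟨M.restrict I f₂, h₂⟩ : M.Preimage I) =
          M.restrict I (P.bracket f₁ f₂) := by
  obtain ⟨Q, hQ⟩ := hH.exists_poissonBracket hI_coisotropic hM
  refine ⟨Q, hQ, fun Q' hQ' => ?_⟩
  have h : Q'.bracket = Q.bracket := by
    ext ⟨x, hx⟩ ⟨y, hy⟩
    obtain ⟨f, rfl⟩ := Fib.inr_mk_surjective I M.moment x
    obtain ⟨g, rfl⟩ := Fib.inr_mk_surjective I M.moment y
    exact (hQ' f g hx hy).trans (hQ f g hx hy).symm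
  cases Q
  cases Q'
  congr
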